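/- Let $-\infty<a<b<\infty$, let $\|\cdot\|$ be the norm of $L^2=L^2(a,b)$ (real-valued functions), and let $\|\cdot\|_\Omega$ be the norm of $L^2(\Omega)$, $\Omega=(a,b)^2$. Let $K$ be an integral operator $Kf(x)=\int_a^b k(x,y)f(y)\,dy$ on $L^2$ with kernel $k\in L^2(\Omega)$ (for instance, $k$ continuous or piecewise continuous), let $K^*$ be its adjoint, and let $\lambda_1\ge\lambda_2\ge\dots\ge 0$ be the eigenvalues of $K^*K$ in decreasing order, counted with multiplicity (continued by zeros if only finitely many are positive). Let $B$ be the closed unit ball of $L^2$. Put $A^0=\{u\in B: u\perp\ker K^*\}$, $A^0_*=\{u\in B: u\perp\ker K\}$, $A^1=K(B)$, $A^1_*=K^*(B)$, and $A^r=K(A^{r-1}_*)$, $A^r_*=K^*(A^{r-1})$ for $r\ge2$. Assume that, with $\partial$ the (weak) derivative, $\partial Kf=f$ for all $f\in A^r_*$ and $\partial K^*g=-g$ for all $g\in A^r$, for every $r\ge0$. Put $\mathcal K^1=K(L^2)$, $\mathcal K^1_*=K^*(L^2)$, and $\mathcal K^r=K(\mathcal K^{r-1}_*)$, $\mathcal K^r_*=K^*(\mathcal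 K^{r-1})$ for $r\ge2$. Here $\mathcal K^r\otimes\mathcal K^r$ denotes the completed tensor product inside $L^2(\Omega)$, i.e. the range of $K_r\otimes K_r$ on $L^2(\Omega)$, where $K_r=KK^*K\cdots$ ($r$ alternating factors) and $K_r\otimes K_r$ is the bounded operator on $L^2(\Omega)$ with $(K_r\otimes K_r)(f\otimes g)=K_rf\otimes K_rg$; it contains all finite sums of products $f(x_1)g(x_2)$ with $f,g\in\mathcal K^r$. For $A\subset L^2$ and a finite-dimensional subspace $\mathbb X\subset L^2$ let $E(A,\mathbb X)=\sup_{u\in A}\|u-Xu\|$, with $X$ the $L^2$-projector onto $\mathbb X$, and let $d_n(A)=\inf_{\dim\mathbb X=n}E(A,\mathbb X)$; $\mathbb X$ is optimal for the $n$-width of $A$ if $\dim\mathbb X\le n$ and $E(A,\mathbb X)=d_n(A)$. Let $n\ge 0$, let $\mathbb X_0\perp\ker K^*$ be a subspace that is optimal for the $n$-width of $A^1$, and let $\mathbb Y_0\perp\ker K$ be a subspace that is optimal for the $n$-width of $A^1_*$. For $p\ge1$ put $\mathbb X_p=K(\mathbb Y_{p-1})$, $\mathbb Y_p=K^*(\mathbb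 X_{p-1})$, let $Y_{p}$ be the $L^2$-projector onto $\mathbb Y_{p}$ for $p\ge 0$, and let $R_{\mathbb X_p}=KY_{p-1}\partial$ for $p\ge1$ be the Ritz projector of $K(L^2)$ onto $\mathbb X_p$. For $\bar p_1,\bar p_2\ge1$ let $$R:=R_{\mathbb X_{\bar p_1}}\otimes R_{\mathbb X_{\bar p_2}}=\bigl(KY_{\bar p_1-1}\otimes KY_{\bar p_2-1}\bigr)\,\partial_1\partial_2$$ be the tensor-product Ritz projector. Let $r\ge2$, $\bar p_1,\bar p_2\ge r-1$ and $u\in\mathcal K^r\otimes\mathcal K^r$. Then the weak derivatives $\partial_1^i\partial_2^ju$, $0\le i,j\le r$, and $\partial_1(u-Ru)$, $\partial_2(u-Ru)$ exist in $L^2(\Omega)$, and $$\|u-Ru\|_\Omega\le\lambda_{n+1}^{r/2}\Bigl(\|\partial_1^ru\|_\Omega+\|\partial_2^ru\|_\Omega+\min\bigl\{\|\partial_1\partial_2^{r-1}u\|_\Omega,\ \|\partial_1^{r-1}\partial_2u\|_\Omega\bigr\}\Bigr),$$ $$\|\partial_1(u-Ru)\|_\Omega\le\lambda_{n+1}^{(r-1)/2}\bigl(\|\partial_1^ru\|_\Omega+\|\partial_1\partial_2^{r-1}u\|_\Omega\bigr),$$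 $$\|\partial_2(u-Ru)\|_\Omega\le\lambda_{n+1}^{(r-1)/2}\bigl(\|\partial_1^{r-1}\partial_2u\|_\Omega+\|\partial_2^ru\|_\Omega\bigr).$$ -/

import Mathlib

open MeasureTheory Set
open scoped TensorProduct RealInnerProductSpace InnerProduct ContDiff ENNReal

namespace TensorRitz
noncomputable section

/-! ### Tensor products of operators on `L²` -/

section Tensor

variable {α : Type*} [MeasurableSpace α] {μ : Measure α}

theorem memLp_tmul (f g : Lp ℝ 2 μ) :
    MemLp (fun z : α × α => f z.1 * g z.2) 2 (μ.prod μ) := by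
  have hf := Lp.memLp f
  have hg := Lp.memLp g
  have hm : AEStronglyMeasurable (fun z : α × α => f z.1 * g z.2) (μ.prod μ) :=
    hf.1.comp_fst.mul hg.1.comp_snd
  rw [memLp_two_iff_integrable_sq hm]
  have := hf.integrable_sq.mul_prod hg.integrable_sq
  refine this.congr (Filter.Eventually.of_forall fun z => ?_)
  simp only [mul_pow]

variable [IsFiniteMeasure μ]

/-- The function `(x₁, x₂) ↦ f x₁ * g x₂` as an element of `L²(μ ⊗ μ)`. -/
def tmul (f g : Lp ℝ 2 μ) : Lp ℝ 2 (μ.prod μ) := (memLp_tmul f g).toLp _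

theorem coeFn_tmul (f g : Lp ℝ 2 μ) :
    tmul f g =ᵐ[μ.prod μ] fun z => f z.1 * g z.2 := MemLp.coeFn_toLp _

theorem inner_tmul (f g f' g' : Lp ℝ 2 μ) :
    ⟪tmul f g, tmul f' g'⟫ = ⟪f, f'⟫ * ⟪g, g'⟫ := by
  simp only [L2.inner_def]
  rw [← integral_prod_mul]
  refine integral_congr_ae ?_
  filter_upwards [coeFn_tmul f g, coeFn_tmul f' g'] with z h1 h2
  simp only [h1, h2, RCLike.inner_apply, conj_trivial]
  ring

theorem tmul_ext {F : Lp ℝ 2 (μ.prod μ)} {f g : Lp ℝ 2 μ}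
    (h : F =ᵐ[μ.prod μ] fun z => f z.1 * g z.2) : F = tmul f g :=
  Lp.ext (h.trans (coeFn_tmul f g).symm)

/-- `tmul` as a bilinear map. -/
def tmulBilin : Lp ℝ 2 μ →ₗ[ℝ] Lp ℝ 2 μ →ₗ[ℝ] Lp ℝ 2 (μ.prod μ) :=
  LinearMap.mk₂ ℝ tmul
    (fun f f' g => by
      symm; refine tmul_ext ?_
      have h := Measure.quasiMeasurePreserving_fst (μ := μ) (ν := μ) |>.ae_eq (Lp.coeFn_add f f')
      filter_upwards [Lp.coeFn_add (tmul f g) (tmul f' g), coeFn_tmul f g, coeFn_tmul f' g, h]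
        with z h1 h2 h3 h4
      simp only [Function.comp_apply, Pi.add_apply] at h4
      simp only [h1, Pi.add_apply, h2, h3, h4]; ring)
    (fun c f g => by
      symm; refine tmul_ext ?_
      have h := Measure.quasiMeasurePreserving_fst (μ := μ) (ν := μ) |>.ae_eq (Lp.coeFn_smul c f)
      filter_upwards [Lp.coeFn_smul c (tmul f g), coeFn_tmul f g, h] with z h1 h2 h4
      simp only [Function.comp_apply, Pi.smul_apply, smul_eq_mul] at h4
      simp only [h1, Pi.smul_apply, smul_eq_mul, h2, h4]; ring)
    (fun f g g' => by
      symm; refine tmul_ext ?_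
      have h := Measure.quasiMeasurePreserving_snd (μ := μ) (ν := μ) |>.ae_eq (Lp.coeFn_add g g')
      filter_upwards [Lp.coeFn_add (tmul f g) (tmul f g'), coeFn_tmul f g, coeFn_tmul f g', h]
        with z h1 h2 h3 h4
      simp only [Function.comp_apply, Pi.add_apply] at h4
      simp only [h1, Pi.add_apply, h2, h3, h4]; ring)
    (fun c f g => by
      symm; refine tmul_ext ?_
      have h := Measure.quasiMeasurePreserving_snd (μ := μ) (ν := μ) |>.ae_eq (Lp.coeFn_smul c g)
      filter_upwards [Lp.coeFn_smul c (tmul f g), coeFn_tmul f g, h] with z h1 h2 h4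
      simp only [Function.comp_apply, Pi.smul_apply, smul_eq_mul] at h4
      simp only [h1, Pi.smul_apply, smul_eq_mul, h2, h4]; ring)

/-- The embedding of the algebraic tensor product `L²(μ) ⊗ L²(μ)` into `L²(μ ⊗ μ)`; its range is
dense. -/
def tensorEmb : Lp ℝ 2 μ ⊗[ℝ] Lp ℝ 2 μ →ₗ[ℝ] Lp ℝ 2 (μ.prod μ) := TensorProduct.lift tmulBilin

@[simp] theorem tensorEmb_tmul (f g : Lp ℝ 2 μ) : tensorEmb (f ⊗ₜ[ℝ] g) = tmul f g := rfl

theorem norm_sq_sum_of_right {ι : Type*} [DecidableEq ι] (s : Finset ι) (e b : ι → Lp ℝ 2 μ)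
    (hb : ∀ i ∈ s, ∀ j ∈ s, ⟪b i, b j⟫ = if i = j then (1 : ℝ) else 0) :
    ‖∑ i ∈ s, tmul (e i) (b i)‖ ^ 2 = ∑ i ∈ s, ‖e i‖ ^ 2 := by
  rw [← real_inner_self_eq_norm_sq, sum_inner]
  refine Finset.sum_congr rfl fun i hi => ?_
  rw [inner_sum, Finset.sum_eq_single i]
  · rw [inner_tmul, hb i hi i hi, if_pos rfl, mul_one, real_inner_self_eq_norm_sq]
  · intro j hj hne
    rw [inner_tmul, hb i hi j hj, if_neg hne.symm, mul_zero]
  · exact fun h => absurd hi h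

theorem norm_sq_sum_of_left {ι : Type*} [DecidableEq ι] (s : Finset ι) (e b : ι → Lp ℝ 2 μ)
    (hb : ∀ i ∈ s, ∀ j ∈ s, ⟪b i, b j⟫ = if i = j then (1 : ℝ) else 0) :
    ‖∑ i ∈ s, tmul (b i) (e i)‖ ^ 2 = ∑ i ∈ s, ‖e i‖ ^ 2 := by
  rw [← real_inner_self_eq_norm_sq, sum_inner]
  refine Finset.sum_congr rfl fun i hi => ?_
  rw [inner_sum, Finset.sum_eq_single i]
  · rw [inner_tmul, hb i hi i hi, if_pos rfl, one_mul, real_inner_self_eq_norm_sq]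
  · intro j hj hne
    rw [inner_tmul, hb i hi j hj, if_neg hne.symm, zero_mul]
  · exact fun h => absurd hi h

theorem exists_orthonormal_expansion {H : Type*} [NormedAddCommGroup H] [InnerProductSpace ℝ H]
    (s : Set H) (hs : s.Finite) :
    ∃ (m : ℕ) (b : Fin m → H), Orthonormal ℝ b ∧ ∀ v ∈ s, v = ∑ i, ⟪b i, v⟫ • b i := by
  have : FiniteDimensional ℝ (Submodule.span ℝ s) := FiniteDimensional.span_of_finite ℝ hs
  let b := stdOrthonormalBasis ℝ (Submodule.span ℝ s)
  refine ⟨_, fun i => (b i : H), ?_, fun v hv => ?_⟩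
  · exact b.orthonormal.comp_linearIsometry (Submodule.subtypeₗᵢ _)
  · have := congrArg (Submodule.subtype _) (b.sum_repr' ⟨v, Submodule.subset_span hv⟩)
    simpa using this.symm

theorem exists_expansion_right {H : Type*} [NormedAddCommGroup H] [InnerProductSpace ℝ H]
    (x : H ⊗[ℝ] H) : ∃ (m : ℕ) (e b : Fin m → H), Orthonormal ℝ b ∧ x = ∑ i, e i ⊗ₜ[ℝ] b i := by
  classical
  obtain ⟨S, hS⟩ := TensorProduct.exists_finset x
  obtain ⟨m, b, hb, hv⟩ := exists_orthonormal_expansion (Prod.snd '' (S : Set (H × H)))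
    (S.finite_toSet.image _)
  refine ⟨m, fun i => ∑ p ∈ S, ⟪b i, p.2⟫ • p.1, b, hb, ?_⟩
  rw [hS]
  simp only [TensorProduct.sum_tmul]
  rw [Finset.sum_comm]
  refine Finset.sum_congr rfl fun p hp => ?_
  conv_lhs => rw [hv p.2 ⟨p, hp, rfl⟩]
  simp only [TensorProduct.tmul_sum, TensorProduct.smul_tmul]

theorem exists_expansion_left {H : Type*} [NormedAddCommGroup H] [InnerProductSpace ℝ H]
    (x : H ⊗[ℝ] H) : ∃ (m : ℕ) (e b : Fin m → H), Orthonormal ℝ b ∧ x = ∑ i, b i ⊗ₜ[ℝ] e i := by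
  obtain ⟨m, e, b, hb, hx⟩ := exists_expansion_right (TensorProduct.comm ℝ H H x)
  refine ⟨m, e, b, hb, ?_⟩
  have := congrArg (TensorProduct.comm ℝ H H) hx
  simpa using this

theorem norm_tensorEmb_map_le (T S : Lp ℝ 2 μ →L[ℝ] Lp ℝ 2 μ) (x : Lp ℝ 2 μ ⊗[ℝ] Lp ℝ 2 μ) :
    ‖tensorEmb (TensorProduct.map (T : Lp ℝ 2 μ →ₗ[ℝ] Lp ℝ 2 μ) (S : Lp ℝ 2 μ →ₗ[ℝ] Lp ℝ 2 μ) x)‖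
      ≤ ‖T‖ * ‖S‖ * ‖tensorEmb x‖ := by
  have key : ∀ (U : Lp ℝ 2 μ →L[ℝ] Lp ℝ 2 μ) (m : ℕ) (e : Fin m → Lp ℝ 2 μ),
      ∑ i, ‖U (e i)‖ ^ 2 ≤ ‖U‖ ^ 2 * ∑ i, ‖e i‖ ^ 2 := by
    intro U m e
    rw [Finset.mul_sum]
    refine Finset.sum_le_sum fun i _ => ?_
    rw [← mul_pow]
    exact pow_le_pow_left₀ (norm_nonneg _) (U.le_opNorm _) 2
  have hr : ∀ y : Lp ℝ 2 μ ⊗[ℝ] Lp ℝ 2 μ,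
      ‖tensorEmb (TensorProduct.map (T : Lp ℝ 2 μ →ₗ[ℝ] Lp ℝ 2 μ) LinearMap.id y)‖
        ≤ ‖T‖ * ‖tensorEmb y‖ := by
    intro y
    obtain ⟨m, e, b, hb, rfl⟩ := exists_expansion_right y
    refine le_of_sq_le_sq ?_ (by positivity)
    simp only [map_sum, TensorProduct.map_tmul, tensorEmb_tmul, LinearMap.id_apply, mul_pow,
      ContinuousLinearMap.coe_coe]
    have hb' := fun i (_ : i ∈ Finset.univ) j (_ : j ∈ Finset.univ) =>
      orthonormal_iff_ite.1 hb i j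
    rw [norm_sq_sum_of_right _ _ _ hb', norm_sq_sum_of_right _ _ _ hb']
    exact key T m e
  have hl : ∀ y : Lp ℝ 2 μ ⊗[ℝ] Lp ℝ 2 μ,
      ‖tensorEmb (TensorProduct.map LinearMap.id (S : Lp ℝ 2 μ →ₗ[ℝ] Lp ℝ 2 μ) y)‖
        ≤ ‖S‖ * ‖tensorEmb y‖ := by
    intro y
    obtain ⟨m, e, b, hb, rfl⟩ := exists_expansion_left y
    refine le_of_sq_le_sq ?_ (by positivity)
    simp only [map_sum, TensorProduct.map_tmul, tensorEmb_tmul, LinearMap.id_apply, mul_pow,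
      ContinuousLinearMap.coe_coe]
    have hb' := fun i (_ : i ∈ Finset.univ) j (_ : j ∈ Finset.univ) =>
      orthonormal_iff_ite.1 hb i j
    rw [norm_sq_sum_of_left _ _ _ hb', norm_sq_sum_of_left _ _ _ hb']
    exact key S m e
  have hx : TensorProduct.map (T : Lp ℝ 2 μ →ₗ[ℝ] Lp ℝ 2 μ) (S : Lp ℝ 2 μ →ₗ[ℝ] Lp ℝ 2 μ) x =
      TensorProduct.map (T : Lp ℝ 2 μ →ₗ[ℝ] Lp ℝ 2 μ) LinearMap.id
        (TensorProduct.map LinearMap.id (S : Lp ℝ 2 μ →ₗ[ℝ] Lp ℝ 2 μ) x) := by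
    rw [← LinearMap.comp_apply, ← TensorProduct.map_comp]; simp
  rw [hx, mul_assoc]
  exact (hr _).trans (mul_le_mul_of_nonneg_left (hl x) (norm_nonneg _))

theorem denseRange_tensorEmb : DenseRange (tensorEmb (μ := μ)) := by
  have : (LinearMap.range (tensorEmb (μ := μ))).topologicalClosure = ⊤ := by
    rw [Submodule.topologicalClosure_eq_top_iff, Submodule.eq_bot_iff]
    intro F hF
    have hFi : Integrable F (μ.prod μ) := (Lp.memLp F).integrable (by norm_num)
    have hrect : ∀ A B : Set α, MeasurableSet A → MeasurableSet B →
        ∫ z in A ×ˢ B, F z ∂(μ.prod μ) = 0 := by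
      intro A B hA hB
      have h0 := (Submodule.mem_orthogonal _ _).1 hF
        (tensorEmb (indicatorConstLp 2 hA (measure_ne_top μ A) (1 : ℝ) ⊗ₜ[ℝ]
          indicatorConstLp 2 hB (measure_ne_top μ B) (1 : ℝ))) ⟨_, rfl⟩
      rw [tensorEmb_tmul, ← tmul_ext (F := indicatorConstLp 2 (hA.prod hB)
        (measure_ne_top (μ.prod μ) _) (1 : ℝ)) ?_, L2.inner_indicatorConstLp_one] at h0
      · exact h0
      · have h1 := Measure.quasiMeasurePreserving_fst (μ := μ) (ν := μ) |>.ae_eq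
          (indicatorConstLp_coeFn (p := 2) (hs := hA) (hμs := measure_ne_top μ A) (c := (1 : ℝ)))
        have h2 := Measure.quasiMeasurePreserving_snd (μ := μ) (ν := μ) |>.ae_eq
          (indicatorConstLp_coeFn (p := 2) (hs := hB) (hμs := measure_ne_top μ B) (c := (1 : ℝ)))
        filter_upwards [indicatorConstLp_coeFn (p := 2) (hs := hA.prod hB)
          (hμs := measure_ne_top (μ.prod μ) _) (c := (1 : ℝ)), h1, h2] with z e1 e2 e3
        simp only [Function.comp_apply] at e2 e3
        rw [e1, e2, e3]
        by_cases ha : z.1 ∈ A <;> by_cases hb : z.2 ∈ B <;> simp [ha, hb]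
    have hall : ∀ s : Set (α × α), MeasurableSet s → ∫ z in s, F z ∂(μ.prod μ) = 0 := by
      intro s hs
      induction s, hs using MeasurableSpace.induction_on_inter generateFrom_prod.symm
        isPiSystem_prod with
      | empty => simp
      | basic t ht =>
        obtain ⟨A, hA, B, hB, rfl⟩ := ht
        exact hrect A B hA hB
      | compl t htm ht =>
        have h := integral_add_compl htm hFi
        have hu := hrect univ univ MeasurableSet.univ MeasurableSet.univ
        rw [univ_prod_univ, setIntegral_univ] at hu
        rw [ht, hu, zero_add] at h
        exact h
      | iUnion f hd hm hf =>
        rw [integral_iUnion hm hd hFi.integrableOn]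
        simp [hf]
    have hz : F =ᵐ[μ.prod μ] 0 :=
      ae_eq_zero_of_forall_setIntegral_eq_of_sigmaFinite
        (fun s _ _ => hFi.integrableOn) (fun s hs _ => hall s hs)
    exact (Lp.eq_zero_iff_ae_eq_zero).2 hz
  intro y
  have hy : y ∈ (LinearMap.range (tensorEmb (μ := μ))).topologicalClosure := by
    rw [this]; trivial
  exact hy

/-- The tensor product `T ⊗ S` of two bounded operators on `L²(μ)`: the unique bounded operator on
`L²(μ ⊗ μ)` with `(T ⊗ S)(f ⊗ g) = T f ⊗ S g`. -/
def tensorOp (T S : Lp ℝ 2 μ →L[ℝ] Lp ℝ 2 μ) : Lp ℝ 2 (μ.prod μ) →L[ℝ] Lp ℝ 2 (μ.prod μ) :=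
  (tensorEmb ∘ₗ TensorProduct.map (T : Lp ℝ 2 μ →ₗ[ℝ] Lp ℝ 2 μ)
    (S : Lp ℝ 2 μ →ₗ[ℝ] Lp ℝ 2 μ)).extendOfNorm tensorEmb

theorem tensorOp_tmul (T S : Lp ℝ 2 μ →L[ℝ] Lp ℝ 2 μ) (f g : Lp ℝ 2 μ) :
    tensorOp T S (tmul f g) = tmul (T f) (S g) := by
  have := LinearMap.extendOfNorm_eq (f := tensorEmb ∘ₗ TensorProduct.map
    (T : Lp ℝ 2 μ →ₗ[ℝ] Lp ℝ 2 μ) (S : Lp ℝ 2 μ →ₗ[ℝ] Lp ℝ 2 μ)) denseRange_tensorEmb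
    ⟨‖T‖ * ‖S‖, norm_tensorEmb_map_le T S⟩ (f ⊗ₜ[ℝ] g)
  simpa using! this

end Tensor

/-! ### Function classes, widths and optimal subspaces in a Hilbert space -/

section Hilbert

variable {H : Type*} [NormedAddCommGroup H] [InnerProductSpace ℝ H] [CompleteSpace H]

/-- The function classes `A^r` of the operator `T`: `A^0` is the part of the closed unit ball `B`
orthogonal to `ker T*`, `A^1 = T(B)`, and `A^(r+1) = T(A_*^r)`, where the classes `A_*^r` are
obtained from `T*` in place of `T`. -/
def functionClass (T : H →L[ℝ] H) : ℕ → Set H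
  | 0 => {u | u ∈ Metric.closedBall (0 : H) 1 ∧ u ∈ (LinearMap.ker (T† : H →ₗ[ℝ] H))ᗮ}
  | 1 => T '' Metric.closedBall (0 : H) 1
  | r + 2 => T '' functionClass (T†) (r + 1)

/-- The spaces `X_p` with `X_0 = X0`, `X_(p+1) = T(Y_p)`, where `Y_0 = Y0`, `Y_(p+1) = T*(X_p)`.
The spaces `Y_p` are those obtained from `T*`, `Y0`, `X0` in place of `T`, `X0`, `Y0`. -/
def approxSpace (T : H →L[ℝ] H) (X0 Y0 : Submodule ℝ H) : ℕ → Submodule ℝ H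
  | 0 => X0
  | p + 1 => (approxSpace (T†) Y0 X0 p).map (T : H →ₗ[ℝ] H)

instance finiteDimensional_approxSpace (T : H →L[ℝ] H) (X0 Y0 : Submodule ℝ H)
    [FiniteDimensional ℝ X0] [FiniteDimensional ℝ Y0] (p : ℕ) :
    FiniteDimensional ℝ (approxSpace T X0 Y0 p) := by
  induction p generalizing T X0 Y0 with
  | zero => assumption
  | succ p ih =>
    have := ih (T†) Y0 X0
    exact inferInstanceAs
      (FiniteDimensional ℝ ((approxSpace (T†) Y0 X0 p).map (T : H →ₗ[ℝ] H)))

/-- `E(A, X)`, the supremum over `u ∈ A` of the distance from `u` to its orthogonal projection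
onto the finite-dimensional subspace `X`. -/
def subspaceError (A : Set H) (X : Submodule ℝ H) [FiniteDimensional ℝ X] : ℝ≥0∞ :=
  ⨆ u ∈ A, ‖u - X.starProjection u‖ₑ

/-- The Kolmogorov `n`-width `d_n(A)`, the infimum of `E(A, X)` over the subspaces `X` of
dimension `n`. -/
def kolmogorovWidth (n : ℕ) (A : Set H) : ℝ≥0∞ :=
  ⨅ (X : Submodule ℝ H) (_ : FiniteDimensional ℝ X) (_ : Module.finrank ℝ X = n),
    subspaceError A X

/-- `X` is optimal for the `n`-width of `A`. -/
def IsOptimal (n : ℕ) (A : Set H) (X : Submodule ℝ H) [FiniteDimensional ℝ X] : Prop :=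
  Module.finrank ℝ X ≤ n ∧ subspaceError A X = kolmogorovWidth n A

/-- `lam 0 ≥ lam 1 ≥ ⋯ ≥ 0` lists the eigenvalues of `S` in decreasing order: every positive number
occurs as often as its multiplicity as an eigenvalue of `S` (if there are only finitely many
positive eigenvalues, the list is therefore continued by zeros). -/
def IsEigenvalueSeq (S : H →L[ℝ] H) (lam : ℕ → ℝ) : Prop :=
  Antitone lam ∧ (∀ l, 0 ≤ lam l) ∧
    ∀ c : ℝ, 0 < c → {l : ℕ | lam l = c}.encard =
      Cardinal.toENat (Module.rank ℝ (Module.End.eigenspace (S : H →ₗ[ℝ] H) c))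

/-- The alternating product `T T* T ⋯` with `r` factors. -/
def iterOp (T : H →L[ℝ] H) : ℕ → H →L[ℝ] H
  | 0 => ContinuousLinearMap.id ℝ H
  | r + 1 => T ∘L iterOp (T†) r

/-- The spaces `𝒦^r` of the operator `T`: `𝒦^1 = T(H)` and `𝒦^(r+1) = T(𝒦_*^r)`, where the spaces
`𝒦_*^r` are obtained from `T*` in place of `T`. -/
def opSpace (T : H →L[ℝ] H) : ℕ → Submodule ℝ H
  | 0 => ⊤
  | r + 1 => (opSpace (T†) r).map (T : H →ₗ[ℝ] H)

theorem opSpace_eq_range (T : H →L[ℝ] H) (r : ℕ) :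
    opSpace T r = LinearMap.range (iterOp T r : H →ₗ[ℝ] H) := by
  induction r generalizing T with
  | zero => exact LinearMap.range_id.symm
  | succ r ih =>
    rw [opSpace, ih, iterOp, ContinuousLinearMap.toLinearMap_comp, LinearMap.range_comp]

end Hilbert

/-! ### The interval, the square, and weak derivatives -/

/-- Lebesgue measure on the interval `(a, b)`. -/
abbrev intervalMeasure (a b : ℝ) : Measure ℝ := volume.restrict (Ioo a b)

/-- `L²(a, b)`. -/
abbrev L2 (a b : ℝ) := Lp ℝ 2 (intervalMeasure a b)

/-- `L²(Ω)` for the square `Ω = (a, b)²`. -/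
abbrev L2Sq (a b : ℝ) := Lp ℝ 2 ((intervalMeasure a b).prod (intervalMeasure a b))

variable {a b : ℝ}

/-- `K` is the integral operator on `L²(a, b)` with the square-integrable kernel `k`. -/
def IsIntegralOperator (k : ℝ → ℝ → ℝ) (K : L2 a b →L[ℝ] L2 a b) : Prop :=
  MemLp (fun z : ℝ × ℝ => k z.1 z.2) 2 ((intervalMeasure a b).prod (intervalMeasure a b)) ∧
    ∀ f : L2 a b, K f =ᵐ[intervalMeasure a b] fun x => ∫ y, k x y * f y ∂intervalMeasure a b

/-- `g` is the weak derivative of `f` on `(a, b)`. -/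
def IsWeakDeriv (f g : L2 a b) : Prop :=
  ∀ φ : ℝ → ℝ, ContDiff ℝ ∞ φ → HasCompactSupport φ → tsupport φ ⊆ Ioo a b →
    ∫ x, f x * deriv φ x ∂intervalMeasure a b = -∫ x, g x * φ x ∂intervalMeasure a b

/-- `v` is the weak partial derivative `∂₁^i ∂₂^j u` on the square `(a, b)²`. -/
def IsWeakPartial (i j : ℕ) (u v : L2Sq a b) : Prop :=
  ∀ φ : ℝ × ℝ → ℝ, ContDiff ℝ ∞ φ → HasCompactSupport φ → tsupport φ ⊆ Ioo a b ×ˢ Ioo a b →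
    ∫ z, u z * iteratedDeriv i (fun s => iteratedDeriv j (fun t => φ (s, t)) z.2) z.1
        ∂((intervalMeasure a b).prod (intervalMeasure a b)) =
      (-1) ^ (i + j) *
        ∫ z, v z * φ z ∂((intervalMeasure a b).prod (intervalMeasure a b))

/-- The weak partial derivative `∂₁^i ∂₂^j u` exists in `L²` of the square. -/
def HasWeakPartial (i j : ℕ) (u : L2Sq a b) : Prop := ∃ v, IsWeakPartial i j u v

open Classical in
/-- The weak partial derivative `∂₁^i ∂₂^j u` (and `0` if there is none in `L²`). -/
def weakPartial (i j : ℕ) (u : L2Sq a b) : L2Sq a b :=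
  if h : HasWeakPartial i j u then h.choose else 0

/-! ### The tensor-product spaces and the tensor-product Ritz projector -/

/-- The (completed) tensor product `𝒦^r ⊗ 𝒦^r`, that is, the range of the operator
`K_r ⊗ K_r` on `L²` of the square, where `K_r = K K* K ⋯` (`r` factors) has range `𝒦^r`. -/
def tensorSpace (K : L2 a b →L[ℝ] L2 a b) (r : ℕ) : Submodule ℝ (L2Sq a b) :=
  LinearMap.range (tensorOp (iterOp K r) (iterOp K r) : L2Sq a b →ₗ[ℝ] L2Sq a b)

theorem tmul_mem_tensorSpace {K : L2 a b →L[ℝ] L2 a b} {r : ℕ} {f g : L2 a b}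
    (hf : f ∈ opSpace K r) (hg : g ∈ opSpace K r) : tmul f g ∈ tensorSpace K r := by
  rw [opSpace_eq_range] at hf hg
  obtain ⟨f', rfl⟩ := hf
  obtain ⟨g', rfl⟩ := hg
  exact ⟨tmul f' g', tensorOp_tmul _ _ _ _⟩

/-- The tensor product `R_{X_{p₁}} ⊗ R_{X_{p₂}}` of the Ritz projectors
`R_{X_p} = K ∘ Y_{p-1} ∘ ∂` (for `1 ≤ p`), where `Y_{p-1}` stands for the `L²`-projector onto the
space `Y_{p-1}`: the operators `K Y_{p₁-1}` and `K Y_{p₂-1}` are tensorized and applied to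
`(∂ ⊗ ∂) u = ∂₁ ∂₂ u`. -/
def tensorRitz (K : L2 a b →L[ℝ] L2 a b) (X0 Y0 : Submodule ℝ (L2 a b))
    [FiniteDimensional ℝ X0] [FiniteDimensional ℝ Y0] (p₁ p₂ : ℕ) (u : L2Sq a b) : L2Sq a b :=
  tensorOp (K ∘L (approxSpace (K†) Y0 X0 (p₁ - 1)).starProjection)
    (K ∘L (approxSpace (K†) Y0 X0 (p₂ - 1)).starProjection) (weakPartial 1 1 u)

end

end TensorRitz

open TensorRitz

/-! Write `r = s + 2`, let `D` be the alternating product `K* K K* ⋯` with `s + 1` factors, and let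
`u = (K D ⊗ K D) F`. Since `∂` undoes `K` on the complement of `ker K`, `∂₁∂₂u = (D ⊗ D) F` and `Ru
= (K Y D ⊗ K Y' D) F`. With `Z = 1 - Y` and `Z' = 1 - Y'`, the operator behind the error is `K Z D ⊗
K D + K D ⊗ K Z' D - K Z D ⊗ K Z' D`.

Put `σ = √(lam n)`; as `lam` is indexed from zero, this is the square root of the eigenvalue
`λ_{n+1}`. The optimal subspaces have error at most `σ` (`norm_starProjection_comp_le_sqrt`),
because the span of the eigenspaces of `K* K` above `lam n` is a competitor of dimension at most
`n`. The error bound is inherited by all `X_p` and `Y_p`, and each further factor of an alternating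
product yields one more `σ` (`norm_starProjection_approxSpace_comp_iterOp_le`). Hence `‖K Z‖ ≤ σ`
and `‖Z D‖ ≤ σ ^ (s + 1)`, and `K Z D = (K Z)(Z D)` has norm at most `σ ^ r`.

Derivatives of `u` strip factors off the left of `K D`, up to sign
(`IsIntegration.exists_weakPartial_eq`). With `L` the innermost factor of `D = G L` and `P` the
projector onto the complement of its kernel, `∂₁^r u` is `± (P ⊗ K D) F` and `∂₁∂₂^(r-1) u` is `± (D
⊗ L) F`. The three error terms factor through these operators (`norm_tensorOp_error_le`); the cross
term can be factored in two ways, whence the minimum. -/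

namespace TensorRitz

/-! ### Algebra and norms of tensor products of operators. -/

section TensorOperator

variable {α : Type*} [MeasurableSpace α] {μ : Measure α} [IsFiniteMeasure μ]

/-- Finite sums of products are dense, so identities between bounded operators on the square need
checking only on products. -/
theorem continuousLinearMap_ext_tmul {E : Type*} [TopologicalSpace E] [T2Space E] [AddCommMonoid E]
    [Module ℝ E] {A B : Lp ℝ 2 (μ.prod μ) →L[ℝ] E}
    (h : ∀ f g : Lp ℝ 2 μ, A (tmul f g) = B (tmul f g)) : A = B := by
  have hlin : (A : Lp ℝ 2 (μ.prod μ) →ₗ[ℝ] E) ∘ₗ tensorEmb =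
      (B : Lp ℝ 2 (μ.prod μ) →ₗ[ℝ] E) ∘ₗ tensorEmb :=
    TensorProduct.ext' fun f g => h f g
  have hfun : (A : Lp ℝ 2 (μ.prod μ) → E) = B :=
    denseRange_tensorEmb.equalizer A.continuous B.continuous
      (funext fun x => LinearMap.congr_fun hlin x)
  exact DFunLike.coe_injective hfun

theorem norm_tensorOp_le (T S : Lp ℝ 2 μ →L[ℝ] Lp ℝ 2 μ) : ‖tensorOp T S‖ ≤ ‖T‖ * ‖S‖ :=
  LinearMap.opNorm_extendOfNorm_le denseRange_tensorEmb (by positivity)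
    (norm_tensorEmb_map_le T S)

theorem tensorOp_comp (T S T' S' : Lp ℝ 2 μ →L[ℝ] Lp ℝ 2 μ) :
    tensorOp T S ∘L tensorOp T' S' = tensorOp (T ∘L T') (S ∘L S') :=
  continuousLinearMap_ext_tmul fun f g => by simp [tensorOp_tmul]

theorem tensorOp_sub_left (T T' S : Lp ℝ 2 μ →L[ℝ] Lp ℝ 2 μ) :
    tensorOp (T - T') S = tensorOp T S - tensorOp T' S :=
  continuousLinearMap_ext_tmul fun f g => by
    simp only [tensorOp_tmul, sub_apply]
    exact LinearMap.map_sub₂ tmulBilin (T f) (T' f) (S g)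

theorem tensorOp_sub_right (T S S' : Lp ℝ 2 μ →L[ℝ] Lp ℝ 2 μ) :
    tensorOp T (S - S') = tensorOp T S - tensorOp T S' :=
  continuousLinearMap_ext_tmul fun f g => by
    simp only [tensorOp_tmul, sub_apply]
    exact (tmulBilin (T f)).map_sub (S g) (S' g)

theorem tensorOp_smul_smul (c d : ℝ) (T S : Lp ℝ 2 μ →L[ℝ] Lp ℝ 2 μ) :
    tensorOp (c • T) (d • S) = (c * d) • tensorOp T S :=
  continuousLinearMap_ext_tmul fun f g => by
    have h : tmulBilin (c • T f) (d • S g) = (c * d) • tmulBilin (T f) (S g) := by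
      rw [LinearMap.map_smul₂, map_smul, smul_smul]
    simp only [tensorOp_tmul, smul_apply]
    exact h

/-- Factoring operators out of a tensor product bounds its norm. -/
theorem norm_tensorOp_comp_apply_le (T S T' S' : Lp ℝ 2 μ →L[ℝ] Lp ℝ 2 μ)
    (F : Lp ℝ 2 (μ.prod μ)) :
    ‖tensorOp (T ∘L T') (S ∘L S') F‖ ≤ ‖T‖ * ‖S‖ * ‖tensorOp T' S' F‖ := by
  rw [← tensorOp_comp]
  exact ((tensorOp T S).le_opNorm _).trans
    (mul_le_mul_of_nonneg_right (norm_tensorOp_le T S) (norm_nonneg _))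

end TensorOperator

/-! ### Compactness of integral operators with square-integrable kernel. -/

section KernelOperator

variable {α : Type*} [MeasurableSpace α] {μ : Measure α} [IsFiniteMeasure μ]

/-- A degenerate kernel gives a finite-rank operator; these are the approximants for general
kernels. -/
theorem exists_isCompactOperator_inner_tensorEmb (x : Lp ℝ 2 μ ⊗[ℝ] Lp ℝ 2 μ) :
    ∃ L : Lp ℝ 2 μ →L[ℝ] Lp ℝ 2 μ, IsCompactOperator L ∧
      ∀ f g, ⟪g, L f⟫ = ⟪tensorEmb x, tmul g f⟫ := by
  induction x with
  | zero => exact ⟨0, isCompactOperator_zero, by simp⟩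
  | tmul e e' =>
    refine ⟨(innerSL ℝ e').smulRight e, ?_, fun f g => ?_⟩
    · have hid : IsCompactOperator (id : ℝ → ℝ) := isCompactOperator_id_iff_locallyCompactSpace.2
        inferInstance
      exact (hid.clm_comp ((1 : ℝ →L[ℝ] ℝ).smulRight e)).comp_clm (innerSL ℝ e')
    · rw [tensorEmb_tmul, inner_tmul]
      simp [inner_smul_right, real_inner_comm, mul_comm]
  | add x y hx hy =>
    obtain ⟨L, hL, h⟩ := hx
    obtain ⟨L', hL', h'⟩ := hy
    refine ⟨L + L', hL.add hL', fun f g => ?_⟩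
    simp [inner_add_right, inner_add_left, h, h']

theorem norm_tmul (f g : Lp ℝ 2 μ) : ‖tmul f g‖ = ‖f‖ * ‖g‖ := by
  have h := inner_tmul f g f g
  simp only [real_inner_self_eq_norm_sq] at h
  rw [← mul_pow] at h
  exact (pow_left_inj₀ (norm_nonneg _) (by positivity) two_ne_zero).1 h

/-- An operator whose bilinear form is given by a square-integrable kernel is compact. -/
theorem isCompactOperator_of_inner_eq (κ : Lp ℝ 2 (μ.prod μ)) (L : Lp ℝ 2 μ →L[ℝ] Lp ℝ 2 μ)
    (h : ∀ f g, ⟪g, L f⟫ = ⟪κ, tmul g f⟫) : IsCompactOperator L := by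
  have hcl := isClosed_setOfPred_isCompactOperator (𝕜₁ := ℝ) (𝕜₂ := ℝ) (σ₁₂ := RingHom.id ℝ)
    (M₁ := Lp ℝ 2 μ) (M₂ := Lp ℝ 2 μ)
  refine hcl.closure_subset (Metric.mem_closure_iff.2 fun ε hε => ?_)
  obtain ⟨x, hx⟩ := denseRange_tensorEmb.exists_dist_lt κ (half_pos hε)
  obtain ⟨L', hc, hL'⟩ := exists_isCompactOperator_inner_tensorEmb x
  refine ⟨L', hc, ?_⟩
  rw [dist_eq_norm] at hx ⊢
  refine lt_of_le_of_lt (ContinuousLinearMap.opNorm_le_bound _ (half_pos hε).le fun f => ?_)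
    (half_lt_self hε)
  -- The form of `L - L'` has kernel `κ - tensorEmb x`, so Cauchy–Schwarz bounds the operator norm
  -- by the `L²` distance of the kernels.
  have hb : ∀ g, ⟪g, (L - L') f⟫ ≤ ε / 2 * ‖f‖ * ‖g‖ := fun g => by
    rw [sub_apply, inner_sub_right, h, hL', ← inner_sub_left]
    refine (real_inner_le_norm _ _).trans ?_
    rw [norm_tmul, mul_assoc, mul_comm ‖f‖]
    exact mul_le_mul_of_nonneg_right hx.le (by positivity)
  have := hb ((L - L') f)
  rw [real_inner_self_eq_norm_sq, sq] at this
  rcases (norm_nonneg ((L - L') f)).eq_or_lt with h0 | h0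
  · rw [← h0]; positivity
  · exact le_of_mul_le_mul_right this h0

end KernelOperator

theorem IsIntegralOperator.isCompactOperator {a b : ℝ} {k : ℝ → ℝ → ℝ} {K : L2 a b →L[ℝ] L2 a b}
    (hK : IsIntegralOperator k K) : IsCompactOperator K := by
  obtain ⟨hk, hKf⟩ := hK
  refine isCompactOperator_of_inner_eq (hk.toLp _) K fun f g => ?_
  rw [L2.inner_def, L2.inner_def]
  have h1 : ∀ᵐ z ∂((intervalMeasure a b).prod (intervalMeasure a b)),
      ⟪hk.toLp _ z, tmul g f z⟫ = k z.1 z.2 * (g z.1 * f z.2) := by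
    filter_upwards [hk.coeFn_toLp, coeFn_tmul g f] with z h1 h2
    rw [h1, h2]
    simp [mul_comm]
  rw [integral_congr_ae h1, integral_prod]
  · refine integral_congr_ae ?_
    filter_upwards [hKf f] with x hx
    rw [hx]
    simp only [RCLike.inner_apply, conj_trivial]
    rw [mul_comm, ← integral_const_mul]
    exact integral_congr_ae (Filter.Eventually.of_forall fun y => by simp only; ring)
  · exact hk.integrable_mul (memLp_tmul g f)

/-! ### Eigenvalue bounds for compact symmetric operators. -/

section Spectral

variable {H : Type*} [NormedAddCommGroup H] [InnerProductSpace ℝ H]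

theorem inner_map_self_le_of_mem_iSup_eigenspace {T : H →L[ℝ] H} (hT : T.IsSymmetric) {M : ℝ}
    {x : H}
    (hx : x ∈ ⨆ c : {c : ℝ // c ≤ M}, Module.End.eigenspace (T : Module.End ℝ H) (c : ℝ)) :
    ⟪T x, x⟫ ≤ M * ‖x‖ ^ 2 := by
  classical
  obtain ⟨f, rfl⟩ := (Submodule.mem_iSup_iff_exists_dfinsupp' _ x).1 hx
  have horth : ∀ i ∈ f.support, ∀ c : ℝ,
      ⟪c • (f i : H), ∑ j ∈ f.support, (f j : H)⟫ = c * ‖(f i : H)‖ ^ 2 := fun i hi c => by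
    rw [inner_sum, Finset.sum_eq_single i]
    · rw [real_inner_smul_left, real_inner_self_eq_norm_sq]
    · intro j _ hne
      have h := hT.orthogonalFamily_eigenspaces
        (fun h : (i : ℝ) = j => hne (Subtype.ext h.symm)) (f i) (f j)
      rw [real_inner_smul_left]
      exact mul_eq_zero_of_right _ h
    · exact fun h => absurd hi h
  rw [DFinsupp.sum, map_sum]
  have hval : ∀ i, T (f i : H) = (i : ℝ) • (f i : H) :=
    fun i => Module.End.mem_eigenspace_iff.1 (f i).2
  have hnorm : ‖∑ j ∈ f.support, (f j : H)‖ ^ 2 = ∑ i ∈ f.support, ‖(f i : H)‖ ^ 2 := by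
    rw [← real_inner_self_eq_norm_sq, sum_inner]
    refine Finset.sum_congr rfl fun i hi => ?_
    have := horth i hi 1
    rwa [one_smul, one_mul] at this
  rw [hnorm, sum_inner, Finset.mul_sum]
  refine Finset.sum_le_sum fun i hi => ?_
  rw [hval, horth i hi]
  exact mul_le_mul_of_nonneg_right i.2 (sq_nonneg _)

/-- By the spectral theorem, the complement of `V` is the closed span `W` of the eigenspaces with
eigenvalue at most `M`. On `W` itself the bound follows by expanding in orthogonal eigenvectors, and
the inequality survives closure. -/
theorem inner_map_self_le_of_orthogonal [CompleteSpace H] {T : H →L[ℝ] H} (hT : T.IsSymmetric)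
    (hc : IsCompactOperator T) {M : ℝ} {V : Submodule ℝ H} [FiniteDimensional ℝ V]
    (hV : V ≤ ⨆ c : {c : ℝ // M < c}, Module.End.eigenspace (T : Module.End ℝ H) (c : ℝ))
    (hV' : ∀ c, M < c → Module.End.eigenspace (T : Module.End ℝ H) c ≤ V)
    {f : H} (hf : f ∈ Vᗮ) : ⟪T f, f⟫ ≤ M * ‖f‖ ^ 2 := by
  set W := ⨆ c : {c : ℝ // c ≤ M}, Module.End.eigenspace (T : Module.End ℝ H) (c : ℝ) with hW
  have hVW : V ≤ Wᗮ := by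
    refine hV.trans (iSup_le fun c => ?_)
    change Module.End.eigenspace (T : Module.End ℝ H) (c : ℝ) ⟂ W
    rw [hW, Submodule.isOrtho_iSup_right]
    exact fun d => hT.orthogonalFamily_eigenspaces.isOrtho
      (fun h : (c : ℝ) = d => absurd c.2 (not_lt.2 (h ▸ d.2)))
  have hfW : f ∈ Wᗮᗮ := by
    refine (Submodule.mem_orthogonal _ _).2 fun w hw => ?_
    -- For `w ⊥ W`, this difference is orthogonal to every eigenspace: to the low ones because `w`
    -- and `V` both are, to the high ones because they lie in `V`. It therefore vanishes, so `w ∈ V`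
    -- and `f ⊥ w`.
    have h1 : w - V.starProjection w ∈ (⨆ c, Module.End.eigenspace (T : Module.End ℝ H) c)ᗮ := by
      rw [← Submodule.iInf_orthogonal, Submodule.mem_iInf]
      intro c
      rcases le_or_gt c M with h | h
      · exact Submodule.orthogonal_le (le_iSup (fun c : {c : ℝ // c ≤ M} =>
          Module.End.eigenspace (T : Module.End ℝ H) (c : ℝ)) ⟨c, h⟩)
          (Wᗮ.sub_mem hw (hVW (V.starProjection_apply_mem w)))
      · exact Submodule.orthogonal_le (hV' c h) (V.sub_starProjection_mem_orthogonal w)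
    rw [ContinuousLinearMap.orthogonalComplement_iSup_eigenspaces_eq_bot hc hT,
      Submodule.mem_bot, sub_eq_zero] at h1
    rw [h1]
    exact (Submodule.mem_orthogonal _ _).1 hf _ (V.starProjection_apply_mem w)
  rw [Submodule.orthogonal_orthogonal_eq_closure] at hfW
  have hcl : IsClosed {x : H | ⟪T x, x⟫ ≤ M * ‖x‖ ^ 2} :=
    isClosed_le (by fun_prop) (by fun_prop)
  exact closure_minimal (fun x hx => inner_map_self_le_of_mem_iSup_eigenspace hT hx) hcl hfW

theorem finrank_finset_sup_le {ι : Type*} [DecidableEq ι] (s : Finset ι) (E : ι → Submodule ℝ H)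
    (hE : ∀ i ∈ s, FiniteDimensional ℝ (E i)) :
    FiniteDimensional ℝ (s.sup E : Submodule ℝ H) ∧
      Module.finrank ℝ (s.sup E : Submodule ℝ H) ≤ ∑ i ∈ s, Module.finrank ℝ (E i) := by
  induction s using Finset.induction_on with
  | empty =>
    rw [Finset.sup_empty]
    exact ⟨inferInstance, by simp⟩
  | insert i s hi ih =>
    obtain ⟨h1, h2⟩ := ih fun j hj => hE j (Finset.mem_insert_of_mem hj)
    have := hE i (Finset.mem_insert_self i s)
    rw [Finset.sup_insert, Finset.sum_insert hi]
    exact ⟨inferInstance, (Submodule.finrank_add_le_finrank_add_finrank _ _).trans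
      (Nat.add_le_add_left h2 _)⟩

/-- A compact symmetric operator is bounded by its `n`-th eigenvalue on the complement of a
subspace of dimension at most `n`. -/
theorem exists_finrank_le_inner_map_self_le [CompleteSpace H] {T : H →L[ℝ] H}
    (hT : T.IsSymmetric) (hc : IsCompactOperator T) {lam : ℕ → ℝ} (hlam : IsEigenvalueSeq T lam)
    (n : ℕ) : ∃ (V : Submodule ℝ H) (_ : FiniteDimensional ℝ V), Module.finrank ℝ V ≤ n ∧
      ∀ f ∈ Vᗮ, ⟪T f, f⟫ ≤ lam n * ‖f‖ ^ 2 := by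
  classical
  obtain ⟨hanti, hnn, hmult⟩ := hlam
  -- By monotonicity every index with `lam l > lam n` is already below `n`, so `J` misses none of
  -- them. The required `V` is the sum of the eigenspaces for the values in `S`.
  let J := (Finset.range n).filter fun l => lam n < lam l
  let S := J.image lam
  have hlt : ∀ l, lam n < lam l → l ∈ J := fun l hl => by
    refine Finset.mem_filter.2 ⟨Finset.mem_range.2 ?_, hl⟩
    by_contra h
    exact absurd (hanti (not_lt.1 h)) (not_le.2 hl)
  have hS : ∀ c ∈ S, lam n < c := fun c hcS => by
    obtain ⟨l, hl, rfl⟩ := Finset.mem_image.1 hcS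
    exact (Finset.mem_filter.1 hl).2
  have hfd : ∀ c, lam n < c →
      FiniteDimensional ℝ (Module.End.eigenspace (T : Module.End ℝ H) c) := fun c hcS =>
    ContinuousLinearMap.finite_dimensional_eigenspace hc c ((hnn n).trans_lt hcS).ne'
  have hrank : ∀ c, lam n < c → (J.filter fun l => lam l = c).card =
      Module.finrank ℝ (Module.End.eigenspace (T : Module.End ℝ H) c) := fun c hcS => by
    have := hfd c hcS
    have h := hmult c ((hnn n).trans_lt hcS)
    have hset : {l : ℕ | lam l = c} = ((J.filter fun l => lam l = c : Finset ℕ) : Set ℕ) := by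
      ext l
      simp only [mem_ofPred_eq, Finset.coe_filter]
      exact ⟨fun h => ⟨hlt l (h ▸ hcS), h⟩, fun h => h.2⟩
    rw [hset, encard_coe_eq_coe_finsetCard] at h
    have h2 := Module.finrank_eq_rank ℝ (Module.End.eigenspace (T : Module.End ℝ H) c)
    have h3 : Cardinal.toENat (Module.rank ℝ (Module.End.eigenspace (T : Module.End ℝ H) c)) =
        (Module.finrank ℝ (Module.End.eigenspace (T : Module.End ℝ H) c) : ℕ∞) := by
      rw [← h2, Cardinal.toENat_nat]
    exact_mod_cast h.trans h3
  obtain ⟨hV1, hV2⟩ := finrank_finset_sup_le S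
    (fun c => Module.End.eigenspace (T : Module.End ℝ H) c) fun c hcS => hfd c (hS c hcS)
  refine ⟨_, hV1, hV2.trans ?_, fun f hf => inner_map_self_le_of_orthogonal hT hc ?_ ?_ hf⟩
  -- Multiplicities count the occurrences in the list, so the dimensions add up to at most `J.card ≤
  -- n`.
  · rw [← Finset.sum_congr rfl fun c hcS => hrank c (hS c hcS), ← Finset.card_eq_sum_card_image]
    exact (Finset.card_filter_le _ _).trans (Finset.card_range n).le
  · refine Finset.sup_le fun c hcS => ?_
    exact le_iSup (fun c : {c : ℝ // lam n < c} =>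
      Module.End.eigenspace (T : Module.End ℝ H) (c : ℝ)) ⟨c, hS c hcS⟩
  · intro c hcn
    by_cases hcS : c ∈ S
    · exact Finset.le_sup (f := fun c => Module.End.eigenspace (T : Module.End ℝ H) c) hcS
    -- A number above `lam n` that is not listed has multiplicity zero, so its eigenspace is
    -- trivial.
    · have := hfd c hcn
      have h0 : (J.filter fun l => lam l = c) = ∅ := Finset.filter_eq_empty_iff.2
        fun l hl hlc => hcS (Finset.mem_image.2 ⟨l, hl, hlc⟩)
      have h1 := hrank c hcn
      rw [h0, Finset.card_empty, eq_comm, Submodule.finrank_eq_zero] at h1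
      rw [h1]
      exact bot_le

end Spectral

/-! ### Optimal subspaces and the spaces generated from them. -/

section Widths

variable {H : Type*} [NormedAddCommGroup H] [InnerProductSpace ℝ H]

/-- The width ranges over subspaces of dimension exactly `n`, while the spectral competitor may be
smaller and has to be enlarged. -/
theorem exists_le_finrank_eq (hH : ¬ FiniteDimensional ℝ H) {n : ℕ} (V : Submodule ℝ H)
    [FiniteDimensional ℝ V] (hV : Module.finrank ℝ V ≤ n) :
    ∃ (W : Submodule ℝ H) (_ : FiniteDimensional ℝ W), V ≤ W ∧ Module.finrank ℝ W = n := by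
  induction n, hV using Nat.le_induction with
  | base => exact ⟨V, inferInstance, le_rfl, rfl⟩
  | succ n _ ih =>
    obtain ⟨W, hW, hVW, rfl⟩ := ih
    have hne : W ≠ ⊤ := fun h => hH (Module.finite_def.2 (h ▸ Module.Finite.iff_fg.1 hW))
    obtain ⟨v, -, hv⟩ := SetLike.exists_of_lt hne.lt_top
    have hlt : W < W ⊔ Submodule.span ℝ {v} :=
      left_lt_sup.2 fun h => hv (h (Submodule.mem_span_singleton_self v))
    refine ⟨W ⊔ Submodule.span ℝ {v}, inferInstance, hVW.trans le_sup_left, le_antisymm ?_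
      (Submodule.finrank_lt_finrank_of_lt hlt)⟩
    exact (Submodule.finrank_add_le_finrank_add_finrank _ _).trans
      (Nat.add_le_add_left ((finrank_span_le_card {v}).trans (by simp)) _)

theorem sub_starProjection_apply (X : Submodule ℝ H) [X.HasOrthogonalProjection] (u : H) :
    u - X.starProjection u = Xᗮ.starProjection u := by
  rw [X.starProjection_orthogonal_val]

theorem starProjection_orthogonal_comp_of_le {V W : Submodule ℝ H} [V.HasOrthogonalProjection]
    [W.HasOrthogonalProjection] (h : V ≤ W) :
    Wᗮ.starProjection ∘L Vᗮ.starProjection = Wᗮ.starProjection := by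
  ext x
  have hV : W.starProjection (V.starProjection x) = V.starProjection x :=
    W.starProjection_eq_self_iff.2 (h (V.starProjection_apply_mem x))
  simp [Submodule.starProjection_orthogonal_val, hV]

/-- If `X` contains `T(Y)`, the error of `X` on the range of `T` only sees the part of the
argument that is orthogonal to `Y`. -/
theorem starProjection_orthogonal_comp_comp {T : H →L[ℝ] H} {X Y : Submodule ℝ H}
    [X.HasOrthogonalProjection] [Y.HasOrthogonalProjection]
    (h : Y.map (T : H →ₗ[ℝ] H) ≤ X) :
    Xᗮ.starProjection ∘L T = (Xᗮ.starProjection ∘L T) ∘L Yᗮ.starProjection := by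
  ext x
  have hT : X.starProjection (T (Y.starProjection x)) = T (Y.starProjection x) :=
    X.starProjection_eq_self_iff.2 (h ⟨_, Y.starProjection_apply_mem x, rfl⟩)
  simp [Submodule.starProjection_orthogonal_val, hT]

theorem norm_starProjection_comp_le (X : Submodule ℝ H) [X.HasOrthogonalProjection]
    (T : H →L[ℝ] H) : ‖X.starProjection ∘L T‖ ≤ ‖T‖ :=
  (ContinuousLinearMap.opNorm_comp_le _ _).trans
    (mul_le_of_le_one_left (norm_nonneg _) X.starProjection_norm_le)

variable [CompleteSpace H]

theorem norm_starProjection_comp_adjoint (X : Submodule ℝ H) [X.HasOrthogonalProjection]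
    (T : H →L[ℝ] H) : ‖X.starProjection ∘L T†‖ = ‖T ∘L X.starProjection‖ := by
  rw [← ContinuousLinearMap.adjoint.norm_map, ContinuousLinearMap.adjoint_comp,
    ContinuousLinearMap.adjoint_adjoint, isSelfAdjoint_starProjection X |>.adjoint_eq]

/-- The error of a subspace on the image of the unit ball is the norm of the complementary projector
composed with `T`, and enlarging the subspace does not increase it. -/
theorem IsOptimal.norm_starProjection_comp_le (hH : ¬ FiniteDimensional ℝ H) {T : H →L[ℝ] H}
    {n : ℕ} {X : Submodule ℝ H} [FiniteDimensional ℝ X] (hX : IsOptimal n (functionClass T 1) X)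
    {V : Submodule ℝ H} [FiniteDimensional ℝ V] (hV : Module.finrank ℝ V ≤ n) {σ : ℝ}
    (hσ : ‖Vᗮ.starProjection ∘L T‖ ≤ σ) : ‖Xᗮ.starProjection ∘L T‖ ≤ σ := by
  have hσ0 : 0 ≤ σ := (norm_nonneg _).trans hσ
  obtain ⟨W, hW, hVW, hWn⟩ := exists_le_finrank_eq hH V hV
  have hWT : ‖Wᗮ.starProjection ∘L T‖ ≤ σ := by
    rw [← starProjection_orthogonal_comp_of_le hVW, ContinuousLinearMap.comp_assoc]
    exact (TensorRitz.norm_starProjection_comp_le _ _).trans hσ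
  have hle : subspaceError (functionClass T 1) X ≤ ENNReal.ofReal σ := by
    rw [hX.2]
    refine (iInf_le_of_le W (iInf_le_of_le hW (iInf_le _ hWn))).trans
      (iSup₂_le fun u hu => ?_)
    obtain ⟨f, hf, rfl⟩ := hu
    rw [sub_starProjection_apply, ← ofReal_norm]
    refine ENNReal.ofReal_le_ofReal ?_
    refine ((Wᗮ.starProjection ∘L T).le_opNorm f).trans ?_
    rw [mem_closedBall_zero_iff] at hf
    exact (mul_le_of_le_one_right (norm_nonneg _) hf).trans hWT
  refine ContinuousLinearMap.opNorm_le_of_unit_norm hσ0 fun f hf => ?_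
  have h := (le_iSup₂ (f := fun u (_ : u ∈ functionClass T 1) => ‖u - X.starProjection u‖ₑ) (T f)
    ⟨f, mem_closedBall_zero_iff.2 hf.le, rfl⟩).trans hle
  rw [sub_starProjection_apply, ← ofReal_norm] at h
  exact (ENNReal.ofReal_le_ofReal_iff hσ0).1 h

/-- Optimal subspaces for the images of the unit ball under `T` and `T*` attain at most the
`n`-th singular value as their error. -/
theorem norm_starProjection_comp_le_sqrt (hH : ¬ FiniteDimensional ℝ H) {T : H →L[ℝ] H}
    (hc : IsCompactOperator T) {lam : ℕ → ℝ} (hlam : IsEigenvalueSeq (T† ∘L T) lam) {n : ℕ}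
    {X Y : Submodule ℝ H} [FiniteDimensional ℝ X] [FiniteDimensional ℝ Y]
    (hX : IsOptimal n (functionClass T 1) X) (hY : IsOptimal n (functionClass (T†) 1) Y) :
    ‖Xᗮ.starProjection ∘L T‖ ≤ √(lam n) ∧ ‖Yᗮ.starProjection ∘L T†‖ ≤ √(lam n) := by
  have hsymm : (T† ∘L T).IsSymmetric := fun x y => by
    change ⟪(T† ∘L T) x, y⟫ = ⟪x, (T† ∘L T) y⟫
    simp [ContinuousLinearMap.adjoint_inner_left, ContinuousLinearMap.adjoint_inner_right]
  obtain ⟨V, hV, hVn, hVf⟩ := exists_finrank_le_inner_map_self_le hsymm (hc.clm_comp (T†)) hlam n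
  have hnn := hlam.2.1 n
  have hTV : ‖T ∘L Vᗮ.starProjection‖ ≤ √(lam n) := by
    refine ContinuousLinearMap.opNorm_le_bound _ (Real.sqrt_nonneg _) fun f => ?_
    have h1 := hVf _ (Vᗮ.starProjection_apply_mem f)
    rw [← RCLike.re_to_real (x := ⟪_, _⟫), ← T.apply_norm_sq_eq_inner_adjoint_left] at h1
    have h2 : ‖Vᗮ.starProjection f‖ ≤ ‖f‖ := Vᗮ.norm_starProjection_apply_le f
    refine le_of_sq_le_sq (h1.trans ?_) (by positivity)
    rw [mul_pow, Real.sq_sqrt hnn]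
    gcongr
  refine ⟨hX.norm_starProjection_comp_le hH (V := V.map (T : H →ₗ[ℝ] H))
    -- One spectral space serves both widths: `T(V)` competes for `T`, and `V` itself for `T*`,
    -- because `(1 - V) T*` is the adjoint of `T (1 - V)`.
    ((Submodule.finrank_map_le _ _).trans hVn) ?_,
    hY.norm_starProjection_comp_le hH hVn ?_⟩
  · rw [starProjection_orthogonal_comp_comp (Y := V) le_rfl, ContinuousLinearMap.comp_assoc]
    exact (TensorRitz.norm_starProjection_comp_le _ _).trans hTV
  · rwa [norm_starProjection_comp_adjoint]

/-- As `X_{q+1} = T(Y_q)`, one has `(1 - X_{q+1}) T = (1 - X_{q+1}) T (1 - Y_q)`. The norm is at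
most that of `T (1 - Y_q)`, whose adjoint is the same problem for `T*` one level lower. -/
theorem norm_starProjection_approxSpace_comp_le {σ : ℝ} {T : H →L[ℝ] H} {X Y : Submodule ℝ H}
    [FiniteDimensional ℝ X] [FiniteDimensional ℝ Y] (hX : ‖Xᗮ.starProjection ∘L T‖ ≤ σ)
    (hY : ‖Yᗮ.starProjection ∘L T†‖ ≤ σ) (q : ℕ) :
    ‖(approxSpace T X Y q)ᗮ.starProjection ∘L T‖ ≤ σ := by
  induction q generalizing T X Y with
  | zero => exact hX
  | succ q ih =>
    have h := ih (X := Y) (Y := X) hY (by rwa [ContinuousLinearMap.adjoint_adjoint])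
    rw [norm_starProjection_comp_adjoint] at h
    rw [starProjection_orthogonal_comp_comp (X := approxSpace T X Y (q + 1))
      (Y := approxSpace (T†) Y X q) le_rfl, ContinuousLinearMap.comp_assoc]
    exact (TensorRitz.norm_starProjection_comp_le _ _).trans h

/-- The complementary projector passes through the outer factor `T`, turning `1 - X_{q+1}` into `1 -
Y_q` at the cost of one `σ`. It can do so once per level, hence the restriction `s ≤ q + 1`. -/
theorem norm_starProjection_approxSpace_comp_iterOp_le {σ : ℝ} {T : H →L[ℝ] H}
    {X Y : Submodule ℝ H} [FiniteDimensional ℝ X] [FiniteDimensional ℝ Y]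
    (hX : ‖Xᗮ.starProjection ∘L T‖ ≤ σ) (hY : ‖Yᗮ.starProjection ∘L T†‖ ≤ σ) {q s : ℕ}
    (hs : s ≤ q + 1) : ‖(approxSpace T X Y q)ᗮ.starProjection ∘L iterOp T s‖ ≤ σ ^ s := by
  induction s generalizing T X Y q with
  | zero =>
    rw [pow_zero]
    exact (approxSpace T X Y q)ᗮ.starProjection_norm_le
  | succ s ih =>
    rcases q with _ | q
    · obtain rfl : s = 0 := by omega
      rw [pow_one]
      exact hX
    · have h := norm_starProjection_approxSpace_comp_le hX hY (q + 1)
      have h' := ih (X := Y) (Y := X) (q := q) hY (by rwa [ContinuousLinearMap.adjoint_adjoint]) (by omega)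
      have hproj : (approxSpace (T†) Y X q)ᗮ.starProjection ∘L
          (approxSpace (T†) Y X q)ᗮ.starProjection = (approxSpace (T†) Y X q)ᗮ.starProjection :=
        starProjection_orthogonal_comp_of_le le_rfl
      rw [iterOp, ← ContinuousLinearMap.comp_assoc,
        starProjection_orthogonal_comp_comp (X := approxSpace T X Y (q + 1))
        (Y := approxSpace (T†) Y X q) le_rfl, ContinuousLinearMap.comp_assoc, pow_succ']
      exact (ContinuousLinearMap.opNorm_comp_le _ _).trans
        (mul_le_mul h h' (norm_nonneg _) ((norm_nonneg _).trans h))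

end Widths

/-! ### Slices and partial derivatives of test functions. -/

section TestFunctions

/-- Smooth functions with compact support in `U`. -/
structure IsTestFunction {E : Type*} [NormedAddCommGroup E] [NormedSpace ℝ E] (U : Set E)
    (φ : E → ℝ) : Prop where
  contDiff : ContDiff ℝ ∞ φ
  hasCompactSupport : HasCompactSupport φ
  tsupport_subset : tsupport φ ⊆ U

theorem IsTestFunction.derivative {U : Set ℝ} {φ : ℝ → ℝ} (h : IsTestFunction U φ) :
    IsTestFunction U (deriv φ) :=
  ⟨h.1.deriv', h.2.deriv, (tsupport_deriv_subset).trans h.3⟩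

theorem IsTestFunction.iteratedDerivative {U : Set ℝ} {φ : ℝ → ℝ} (h : IsTestFunction U φ) (i : ℕ) :
    IsTestFunction U (iteratedDeriv i φ) := by
  induction i with
  | zero => rwa [iteratedDeriv_zero]
  | succ i ih => rw [iteratedDeriv_succ]; exact ih.derivative

theorem IsTestFunction.memLp {E : Type*} [NormedAddCommGroup E] [NormedSpace ℝ E]
    [MeasurableSpace E] [OpensMeasurableSpace E] {U : Set E} {φ : E → ℝ}
    (h : IsTestFunction U φ) {μ : Measure E} [IsFiniteMeasure μ] (p : ℝ≥0∞)
    [SecondCountableTopologyEither E ℝ] : MemLp φ p μ :=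
  h.1.continuous.memLp_of_hasCompactSupport h.2

/-- Slices of test functions on a product are test functions. -/
theorem IsTestFunction.slice_left {U V : Set ℝ} {φ : ℝ × ℝ → ℝ} (h : IsTestFunction (U ×ˢ V) φ)
    (t : ℝ) : IsTestFunction U fun s => φ (s, t) := by
  have hsub : tsupport (fun s => φ (s, t)) ⊆ (fun s => (s, t)) ⁻¹' tsupport φ :=
    closure_minimal (fun s hs => subset_tsupport φ hs)
      ((isClosed_tsupport φ).preimage (by fun_prop))
  refine ⟨h.1.comp (contDiff_id.prodMk contDiff_const), ?_, fun s hs => (h.3 (hsub hs)).1⟩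
  refine (h.2.isCompact.image continuous_fst).of_isClosed_subset (isClosed_tsupport _) ?_
  exact fun s hs => ⟨(s, t), hsub hs, rfl⟩

theorem IsTestFunction.slice_right {U V : Set ℝ} {φ : ℝ × ℝ → ℝ} (h : IsTestFunction (U ×ˢ V) φ)
    (s : ℝ) : IsTestFunction V fun t => φ (s, t) := by
  have hsub : tsupport (fun t => φ (s, t)) ⊆ (fun t => (s, t)) ⁻¹' tsupport φ :=
    closure_minimal (fun t ht => subset_tsupport φ ht)
      ((isClosed_tsupport φ).preimage (by fun_prop))
  refine ⟨h.1.comp (contDiff_const.prodMk contDiff_id), ?_, fun t ht => (h.3 (hsub ht)).2⟩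
  refine (h.2.isCompact.image continuous_snd).of_isClosed_subset (isClosed_tsupport _) ?_
  exact fun t ht => ⟨(s, t), hsub ht, rfl⟩

theorem deriv_slice_left {φ : ℝ × ℝ → ℝ} (h : ContDiff ℝ ∞ φ) (z : ℝ × ℝ) :
    deriv (fun s => φ (s, z.2)) z.1 = fderiv ℝ φ z (1, 0) := by
  have h1 := (h.differentiable (by simp)).differentiableAt.hasFDerivAt (x := z)
  have h2 : HasDerivAt (fun s : ℝ => (s, z.2)) ((1 : ℝ), (0 : ℝ)) z.1 :=
    (hasDerivAt_id _).prodMk (hasDerivAt_const _ _)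
  exact (h1.comp_hasDerivAt z.1 h2).deriv

theorem deriv_slice_right {φ : ℝ × ℝ → ℝ} (h : ContDiff ℝ ∞ φ) (z : ℝ × ℝ) :
    deriv (fun t => φ (z.1, t)) z.2 = fderiv ℝ φ z (0, 1) := by
  have h1 := (h.differentiable (by simp)).differentiableAt.hasFDerivAt (x := z)
  have h2 : HasDerivAt (fun t : ℝ => (z.1, t)) ((0 : ℝ), (1 : ℝ)) z.2 :=
    (hasDerivAt_const _ _).prodMk (hasDerivAt_id _)
  exact (h1.comp_hasDerivAt z.2 h2).deriv

theorem IsTestFunction.fderiv_apply {E : Type*} [NormedAddCommGroup E] [NormedSpace ℝ E]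
    {U : Set E} {φ : E → ℝ} (h : IsTestFunction U φ) (v : E) :
    IsTestFunction U fun z => fderiv ℝ φ z v := by
  have hsub : tsupport (fun z => fderiv ℝ φ z v) ⊆ tsupport φ :=
    closure_minimal (fun z hz => support_fderiv_subset ℝ (fun h0 => hz (by simp [h0])))
      (isClosed_tsupport φ)
  exact ⟨(h.1.fderiv_right (by simp)).clm_apply contDiff_const,
    h.2.isCompact.of_isClosed_subset (isClosed_tsupport _) hsub, hsub.trans h.3⟩

/-- Joint smoothness in `z` is seen by rewriting each slice derivative as the Fréchet derivative in
a fixed direction. -/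
theorem IsTestFunction.iteratedDeriv_slice_left {U : Set (ℝ × ℝ)} {φ : ℝ × ℝ → ℝ}
    (h : IsTestFunction U φ) (i : ℕ) :
    IsTestFunction U fun z => iteratedDeriv i (fun s => φ (s, z.2)) z.1 := by
  induction i with
  | zero => simpa only [iteratedDeriv_zero] using h
  | succ i ih =>
    simp only [iteratedDeriv_succ]
    have := ih.fderiv_apply (1, 0)
    simpa only [← deriv_slice_left ih.1] using this

theorem IsTestFunction.iteratedDeriv_slice_right {U : Set (ℝ × ℝ)} {φ : ℝ × ℝ → ℝ}
    (h : IsTestFunction U φ) (j : ℕ) :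
    IsTestFunction U fun z => iteratedDeriv j (fun t => φ (z.1, t)) z.2 := by
  induction j with
  | zero => simpa only [iteratedDeriv_zero] using h
  | succ j ih =>
    simp only [iteratedDeriv_succ]
    have := ih.fderiv_apply (0, 1)
    simpa only [← deriv_slice_right ih.1] using this

end TestFunctions

/-! ### Weak derivatives on the interval and the square. -/

section WeakDerivatives

variable {a b : ℝ}

/-- `g` is the weak derivative of order `i` of `f` on `(a, b)`. -/
def IsIterWeakDeriv (i : ℕ) (f g : L2 a b) : Prop :=
  ∀ φ : ℝ → ℝ, IsTestFunction (Ioo a b) φ →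
    ∫ x, f x * iteratedDeriv i φ x ∂intervalMeasure a b =
      (-1) ^ i * ∫ x, g x * φ x ∂intervalMeasure a b

theorem isIterWeakDeriv_zero (f : L2 a b) : IsIterWeakDeriv 0 f f := fun φ _ => by simp

theorem IsWeakDeriv.isIterWeakDeriv_succ {f g h : L2 a b} {i : ℕ} (hf : IsWeakDeriv f g)
    (hg : IsIterWeakDeriv i g h) : IsIterWeakDeriv (i + 1) f h := fun φ hφ => by
  have hi := hφ.iteratedDerivative i
  rw [iteratedDeriv_succ, hf _ hi.1 hi.2 hi.3, hg φ hφ]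
  ring

theorem integral_smul_mul {α : Type*} [MeasurableSpace α] {μ : Measure α} (c : ℝ) (f : Lp ℝ 2 μ)
    (ψ : α → ℝ) : ∫ x, (c • f : Lp ℝ 2 μ) x * ψ x ∂μ = c * ∫ x, f x * ψ x ∂μ := by
  rw [← integral_const_mul]
  refine integral_congr_ae ?_
  filter_upwards [Lp.coeFn_smul c f] with x hx
  rw [hx, Pi.smul_apply, smul_eq_mul, mul_assoc]

theorem IsWeakDeriv.smul {f g : L2 a b} (h : IsWeakDeriv f g) (c : ℝ) :
    IsWeakDeriv (c • f) (c • g) := fun φ h1 h2 h3 => by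
  rw [integral_smul_mul, integral_smul_mul, h φ h1 h2 h3, mul_neg]

theorem IsIterWeakDeriv.smul {i : ℕ} {f g : L2 a b} (h : IsIterWeakDeriv i f g) (c : ℝ) :
    IsIterWeakDeriv i (c • f) (c • g) := fun φ hφ => by
  rw [integral_smul_mul, integral_smul_mul, h φ hφ]
  ring

/-- Integration against a square-integrable function as a bounded functional. -/
theorem exists_clm_integral_mul {α : Type*} [MeasurableSpace α] {μ : Measure α} {ψ : α → ℝ}
    (hψ : MemLp ψ 2 μ) : ∃ L : Lp ℝ 2 μ →L[ℝ] ℝ, ∀ f, L f = ∫ x, f x * ψ x ∂μ := by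
  refine ⟨innerSL ℝ (hψ.toLp ψ), fun f => ?_⟩
  rw [innerSL_apply_apply, L2.inner_def]
  refine integral_congr_ae ?_
  filter_upwards [hψ.coeFn_toLp] with x hx
  rw [hx]
  simp

theorem integral_tmul_mul {α : Type*} [MeasurableSpace α] {μ : Measure α} [IsFiniteMeasure μ]
    (f g : Lp ℝ 2 μ) {ψ : α × α → ℝ} (hψ : MemLp ψ 2 (μ.prod μ)) :
    ∫ z, tmul f g z * ψ z ∂(μ.prod μ) = ∫ s, f s * ∫ t, g t * ψ (s, t) ∂μ ∂μ := by
  have h1 : (fun z => tmul f g z * ψ z) =ᵐ[μ.prod μ] fun z => f z.1 * g z.2 * ψ z := by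
    filter_upwards [coeFn_tmul f g] with z hz
    rw [hz]
  have h2 : Integrable (fun z : α × α => f z.1 * g z.2 * ψ z) (μ.prod μ) :=
    (memLp_tmul f g).integrable_mul hψ
  rw [integral_congr_ae h1, integral_prod _ h2]
  simp only [mul_assoc, integral_const_mul]

theorem integral_tmul_mul_swap {α : Type*} [MeasurableSpace α] {μ : Measure α} [IsFiniteMeasure μ]
    (f g : Lp ℝ 2 μ) {ψ : α × α → ℝ} (hψ : MemLp ψ 2 (μ.prod μ)) :
    ∫ z, tmul f g z * ψ z ∂(μ.prod μ) = ∫ t, g t * ∫ s, f s * ψ (s, t) ∂μ ∂μ := by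
  have h1 : (fun z => tmul f g z * ψ z) =ᵐ[μ.prod μ] fun z => f z.1 * g z.2 * ψ z := by
    filter_upwards [coeFn_tmul f g] with z hz
    rw [hz]
  have h2 : Integrable (fun z : α × α => f z.1 * g z.2 * ψ z) (μ.prod μ) :=
    (memLp_tmul f g).integrable_mul hψ
  rw [integral_congr_ae h1, integral_prod_symm _ h2]
  refine integral_congr_ae (Filter.Eventually.of_forall fun t => ?_)
  simp only
  rw [← integral_const_mul]
  exact integral_congr_ae (Filter.Eventually.of_forall fun s => by simp only; ring)

/-- Fubini in both orders: the derivatives in each variable are moved by applying the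
one-dimensional identity to slices of the test function. -/
theorem isWeakPartial_tmul {i j : ℕ} {f f' g g' : L2 a b} (hf : IsIterWeakDeriv i f f')
    (hg : IsIterWeakDeriv j g g') : IsWeakPartial i j (tmul f g) (tmul f' g') := by
  intro φ h1 h2 h3
  have hφ : IsTestFunction (Ioo a b ×ˢ Ioo a b) φ := ⟨h1, h2, h3⟩
  have hj := hφ.iteratedDeriv_slice_right j
  have hij := hj.iteratedDeriv_slice_left i
  have e1 : ∀ t, ∫ s, f s * iteratedDeriv i
      (fun s => iteratedDeriv j (fun t => φ (s, t)) t) s ∂intervalMeasure a b =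
      (-1) ^ i * ∫ s, f' s * iteratedDeriv j (fun t => φ (s, t)) t ∂intervalMeasure a b :=
    fun t => hf _ (hj.slice_left t)
  have e2 : ∀ s, ∫ t, g t * iteratedDeriv j (fun t => φ (s, t)) t ∂intervalMeasure a b =
      (-1) ^ j * ∫ t, g' t * φ (s, t) ∂intervalMeasure a b := fun s => hg _ (hφ.slice_right s)
  calc _ = ∫ t, g t * ((-1) ^ i * ∫ s, f' s * iteratedDeriv j (fun t => φ (s, t)) t
            ∂intervalMeasure a b) ∂intervalMeasure a b := by
        rw [integral_tmul_mul_swap f g (hij.memLp 2)]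
        simp only [e1]
    _ = (-1) ^ i * ∫ z, tmul f' g z * iteratedDeriv j (fun t => φ (z.1, t)) z.2
          ∂((intervalMeasure a b).prod (intervalMeasure a b)) := by
        rw [integral_tmul_mul_swap f' g (hj.memLp 2), ← integral_const_mul]
        exact integral_congr_ae (Filter.Eventually.of_forall fun t => by simp only; ring)
    _ = (-1) ^ i * ∫ s, f' s * ((-1) ^ j * ∫ t, g' t * φ (s, t) ∂intervalMeasure a b)
          ∂intervalMeasure a b := by
        rw [integral_tmul_mul f' g (hj.memLp 2)]
        simp only [e2]
    _ = _ := by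
        rw [integral_tmul_mul f' g' (hφ.memLp 2), pow_add, mul_assoc, ← integral_const_mul ((-1) ^ j)]
        congr 1
        exact integral_congr_ae (Filter.Eventually.of_forall fun t => by simp only; ring)

/-- For a fixed test function both sides are bounded functionals of `F`, so the case of products
suffices. -/
theorem isWeakPartial_tensorOp {i j : ℕ} {A A' B B' : L2 a b →L[ℝ] L2 a b}
    (hA : ∀ f, IsIterWeakDeriv i (A f) (A' f)) (hB : ∀ f, IsIterWeakDeriv j (B f) (B' f))
    (F : L2Sq a b) : IsWeakPartial i j (tensorOp A B F) (tensorOp A' B' F) := by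
  intro φ h1 h2 h3
  have hφ : IsTestFunction (Ioo a b ×ˢ Ioo a b) φ := ⟨h1, h2, h3⟩
  obtain ⟨L, hL⟩ := exists_clm_integral_mul
    (((hφ.iteratedDeriv_slice_right j).iteratedDeriv_slice_left i).memLp
      (μ := (intervalMeasure a b).prod (intervalMeasure a b)) 2)
  obtain ⟨L', hL'⟩ := exists_clm_integral_mul
    (hφ.memLp (μ := (intervalMeasure a b).prod (intervalMeasure a b)) 2)
  have key : L ∘L tensorOp A B = ((-1 : ℝ) ^ (i + j)) • (L' ∘L tensorOp A' B') := by
    refine continuousLinearMap_ext_tmul fun f g => ?_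
    simp only [ContinuousLinearMap.comp_apply, smul_apply, tensorOp_tmul, hL, hL', smul_eq_mul]
    exact isWeakPartial_tmul (hA f) (hB g) φ h1 h2 h3
  have h := DFunLike.congr_fun key F
  simp only [ContinuousLinearMap.comp_apply, smul_apply, hL, hL', smul_eq_mul] at h
  exact h

/-- The fundamental lemma of the calculus of variations on the open square; it identifies the chosen
`weakPartial` with any computed derivative. -/
theorem IsWeakPartial.unique {i j : ℕ} {u v w : L2Sq a b} (hv : IsWeakPartial i j u v)
    (hw : IsWeakPartial i j u w) : v = w := by
  rw [← sub_eq_zero, Lp.eq_zero_iff_ae_eq_zero]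
  have hμ : (intervalMeasure a b).prod (intervalMeasure a b) =
      (volume : Measure (ℝ × ℝ)).restrict (Ioo a b ×ˢ Ioo a b) := by
    rw [Measure.prod_restrict]
    rfl
  have hint : Integrable (v - w : L2Sq a b) ((intervalMeasure a b).prod (intervalMeasure a b)) :=
    (Lp.memLp _).integrable (by norm_num)
  have h0 := (isOpen_Ioo (a := a) (b := b) |>.prod (isOpen_Ioo (a := a) (b := b))
    ).ae_eq_zero_of_integral_contDiff_smul_eq_zero
    (hint.locallyIntegrable.locallyIntegrableOn _) fun φ h1 h2 h3 => by
      have hφ : IsTestFunction (Ioo a b ×ˢ Ioo a b) φ := ⟨h1, h2, h3⟩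
      obtain ⟨L, hL⟩ := exists_clm_integral_mul
        (hφ.memLp (μ := (intervalMeasure a b).prod (intervalMeasure a b)) 2)
      have he : L v = L w := by
        rw [hL, hL]
        exact mul_left_cancel₀ (by simp) ((hv φ h1 h2 h3).symm.trans (hw φ h1 h2 h3))
      have := hL (v - w)
      rw [map_sub, he, sub_self] at this
      simp only [smul_eq_mul, mul_comm (φ _)]
      exact this.symm
  have hmem : ∀ᵐ z ∂((intervalMeasure a b).prod (intervalMeasure a b)),
      z ∈ Ioo a b ×ˢ Ioo a b := by
    rw [hμ]
    exact ae_restrict_mem (measurableSet_Ioo.prod measurableSet_Ioo)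
  filter_upwards [h0, hmem] with z hz hzm using hz hzm

theorem IsWeakPartial.weakPartial_eq {i j : ℕ} {u v : L2Sq a b} (h : IsWeakPartial i j u v) :
    weakPartial i j u = v := by
  have hex : HasWeakPartial i j u := ⟨v, h⟩
  rw [weakPartial, dif_pos hex]
  exact IsWeakPartial.unique hex.choose_spec h

theorem IsWeakPartial.sub {i j : ℕ} {u u' v v' : L2Sq a b} (h : IsWeakPartial i j u v)
    (h' : IsWeakPartial i j u' v') : IsWeakPartial i j (u - u') (v - v') := by
  intro φ h1 h2 h3
  have hφ : IsTestFunction (Ioo a b ×ˢ Ioo a b) φ := ⟨h1, h2, h3⟩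
  obtain ⟨L, hL⟩ := exists_clm_integral_mul
    (((hφ.iteratedDeriv_slice_right j).iteratedDeriv_slice_left i).memLp
      (μ := (intervalMeasure a b).prod (intervalMeasure a b)) 2)
  obtain ⟨L', hL'⟩ := exists_clm_integral_mul
    (hφ.memLp (μ := (intervalMeasure a b).prod (intervalMeasure a b)) 2)
  have e := h φ h1 h2 h3
  have e' := h' φ h1 h2 h3
  rw [← hL'] at e e' ⊢
  have e1 := (hL u).trans e
  have e1' := (hL u').trans e'
  refine (hL (u - u')).symm.trans ?_
  rw [map_sub, map_sub, e1, e1', mul_sub]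

end WeakDerivatives

/-! ### Infinite dimension of `L²(a, b)`. -/

section InfiniteDimensional

/-- Indicators of disjoint intervals accumulating at `a` are orthogonal and nonzero. -/
theorem not_finiteDimensional_L2 {a b : ℝ} (hab : a < b) : ¬ FiniteDimensional ℝ (L2 a b) := by
  intro hfd
  have hd : 0 < b - a := sub_pos.2 hab
  let c : ℕ → ℝ := fun m => a + (b - a) / (m + 1)
  have hc : StrictAnti c := strictAnti_nat_of_succ_lt fun m => by
    simp only [c]
    gcongr
    simp
  let I : ℕ → Set ℝ := fun m => Ioo (c (m + 1)) (c m)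
  have hI : ∀ m, I m ⊆ Ioo a b := fun m => Ioo_subset_Ioo
    (le_add_of_nonneg_right (by positivity)) (by
      have : c m ≤ c 0 := hc.antitone m.zero_le
      simpa [c] using this)
  have hpos : ∀ m, intervalMeasure a b (I m) ≠ 0 := fun m => by
    rw [intervalMeasure, Measure.restrict_apply measurableSet_Ioo, inter_eq_left.2 (hI m),
      Real.volume_Ioo]
    simpa using hc m.lt_succ_self
  let e : ℕ → L2 a b := fun m =>
    indicatorConstLp 2 (measurableSet_Ioo (a := c (m + 1)) (b := c m))
      (measure_ne_top (intervalMeasure a b) _) (1 : ℝ)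
  have hdisj : ∀ m l, m < l → Disjoint (I m) (I l) := fun m l hml => by
    rw [Set.disjoint_left]
    intro x hx hx'
    exact absurd (hx'.2.trans_le (hc.antitone hml)) (not_lt.2 hx.1.le)
  have hli : LinearIndependent ℝ e := by
    refine linearIndependent_of_ne_zero_of_inner_eq_zero (fun m h0 => ?_) fun m l hml => ?_
    · have h1 := congrArg norm h0
      rw [norm_indicatorConstLp (by norm_num) (by norm_num), norm_zero] at h1
      have h2 : 0 < (intervalMeasure a b).real (I m) :=
        ENNReal.toReal_pos (hpos m) (measure_ne_top _ _)
      have : 0 < ‖(1 : ℝ)‖ * (intervalMeasure a b).real (I m) ^ (1 / (2 : ℝ≥0∞).toReal) := by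
        rw [norm_one, one_mul]
        exact Real.rpow_pos_of_pos h2 _
      exact this.ne' h1
    · have hd' : Disjoint (I m) (I l) := by
        rcases lt_or_gt_of_ne hml with h | h
        · exact hdisj m l h
        · exact (hdisj l m h).symm
      change ⟪e m, e l⟫ = 0
      simp only [e]
      rw [L2.inner_indicatorConstLp_one, setIntegral_congr_ae (g := 0) measurableSet_Ioo]
      · simp
      · filter_upwards [indicatorConstLp_coeFn (p := 2)
          (hs := measurableSet_Ioo (a := c (l + 1)) (b := c l))
          (hμs := measure_ne_top (intervalMeasure a b) _) (c := (1 : ℝ))] with x hx hxm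
        rw [hx]
        exact indicator_of_notMem (Set.disjoint_left.1 hd' hxm) _
  exact Module.Finite.not_linearIndependent_of_infinite e hli

end InfiniteDimensional

/-! ### Factors and kernels of alternating products. -/

section AlternatingProducts

variable {H : Type*} [NormedAddCommGroup H] [InnerProductSpace ℝ H] [CompleteSpace H]

/-- `T` with the adjoint taken `i` times. -/
noncomputable def altAdj (T : H →L[ℝ] H) : ℕ → H →L[ℝ] H
  | 0 => T
  | i + 1 => altAdj (T†) i

theorem iterOp_succ_eq_comp_altAdj (T : H →L[ℝ] H) (m : ℕ) :
    iterOp T (m + 1) = iterOp T m ∘L altAdj T m := by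
  induction m generalizing T with
  | zero => rfl
  | succ m ih => rw [iterOp, ih, ← ContinuousLinearMap.comp_assoc]; rfl

theorem adjoint_apply_mem_orthogonal_ker (T : H →L[ℝ] H) (x : H) :
    (T†) x ∈ (LinearMap.ker (T : H →ₗ[ℝ] H))ᗮ := by
  refine (Submodule.mem_orthogonal _ _).2 fun y hy => ?_
  have hy' : T y = 0 := hy
  rw [ContinuousLinearMap.adjoint_inner_right, hy', inner_zero_left]

theorem comp_starProjection_orthogonal_ker (T : H →L[ℝ] H) :
    T ∘L (LinearMap.ker (T : H →ₗ[ℝ] H))ᗮ.starProjection = T := by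
  ext x
  have h := Submodule.sub_starProjection_mem_orthogonal
    (K := (LinearMap.ker (T : H →ₗ[ℝ] H))ᗮ) x
  have hcl : IsClosed ((LinearMap.ker (T : H →ₗ[ℝ] H) : Submodule ℝ H) : Set H) :=
    T.isClosed_ker
  rw [Submodule.orthogonal_orthogonal_eq_closure, hcl.submodule_topologicalClosure_eq] at h
  have h' : T (x - (LinearMap.ker (T : H →ₗ[ℝ] H))ᗮ.starProjection x) = 0 := h
  rw [map_sub, sub_eq_zero] at h'
  exact h'.symm

/-- Applied to `K*`, this puts the range of each projector `Y` where `∂` inverts `K`. -/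
theorem approxSpace_le_orthogonal_ker {T : H →L[ℝ] H} {X Y : Submodule ℝ H}
    (hX : X ≤ (LinearMap.ker (T† : H →ₗ[ℝ] H))ᗮ) (q : ℕ) :
    approxSpace T X Y q ≤ (LinearMap.ker (T† : H →ₗ[ℝ] H))ᗮ := by
  rcases q with _ | q
  · exact hX
  · rintro _ ⟨y, -, rfl⟩
    have := adjoint_apply_mem_orthogonal_ker (T†) y
    rwa [ContinuousLinearMap.adjoint_adjoint] at this

end AlternatingProducts

/-! ### Differentiation of alternating products. -/

section Derivatives

variable {a b : ℝ}

/-- `T` and `T*` are integration operators up to the signs `ε` and `-ε`. -/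
def IsIntegration (T : L2 a b →L[ℝ] L2 a b) (ε : ℝ) : Prop :=
  (∀ f ∈ (LinearMap.ker (T : L2 a b →ₗ[ℝ] L2 a b))ᗮ, IsWeakDeriv (T f) (ε • f)) ∧
    ∀ g ∈ (LinearMap.ker (T† : L2 a b →ₗ[ℝ] L2 a b))ᗮ, IsWeakDeriv ((T†) g) ((-ε) • g)

theorem IsIntegration.adjoint {T : L2 a b →L[ℝ] L2 a b} {ε : ℝ} (h : IsIntegration T ε) :
    IsIntegration (T†) (-ε) := by
  refine ⟨h.2, ?_⟩
  rw [ContinuousLinearMap.adjoint_adjoint, neg_neg]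
  exact h.1

/-- Homogeneity: normalize `f`, then scale back. -/
theorem isWeakDeriv_of_forall_closedBall {T : L2 a b →L[ℝ] L2 a b} {ε : ℝ}
    {V : Submodule ℝ (L2 a b)}
    (h : ∀ f ∈ Metric.closedBall (0 : L2 a b) 1, f ∈ V → IsWeakDeriv (T f) (ε • f)) {f : L2 a b}
    (hf : f ∈ V) : IsWeakDeriv (T f) (ε • f) := by
  rcases eq_or_ne f 0 with rfl | h0
  · exact h 0 (by simp) hf
  · have hn : ‖f‖ ≠ 0 := norm_ne_zero_iff.2 h0
    have h1 := (h (‖f‖⁻¹ • f) (by simp [norm_smul, inv_mul_cancel₀ hn])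
      (V.smul_mem _ hf)).smul ‖f‖
    rwa [← map_smul, smul_comm ‖f‖ ε, smul_smul, mul_inv_cancel₀ hn, one_smul] at h1

theorem IsIntegration.exists_isIterWeakDeriv_iterOp {T : L2 a b →L[ℝ] L2 a b} {ε : ℝ}
    (h : IsIntegration T ε) (hε : |ε| = 1) (m i : ℕ) :
    ∃ c : ℝ, |c| = 1 ∧ ∀ f : L2 a b, (∀ s, s + 1 = m + i →
        f ∈ (LinearMap.ker (altAdj T s : L2 a b →ₗ[ℝ] L2 a b))ᗮ) →
      IsIterWeakDeriv i (iterOp T (m + i) f) (c • iterOp (altAdj T i) m f) := by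
  induction i generalizing T ε with
  | zero =>
    refine ⟨1, abs_one, fun f _ => ?_⟩
    rw [one_smul]
    exact isIterWeakDeriv_zero _
  | succ i ih =>
    obtain ⟨c, hc, hcf⟩ := ih h.adjoint (by rwa [abs_neg])
    refine ⟨ε * c, by rw [abs_mul, hε, hc, one_mul], fun f hf => ?_⟩
    -- What follows the outer `T` must be orthogonal to `ker T`. If a factor remains, it is in the
    -- range of `T*`; otherwise it is `f`, and the assumption on the innermost factor applies.
    have hmem : iterOp (T†) (m + i) f ∈ (LinearMap.ker (T : L2 a b →ₗ[ℝ] L2 a b))ᗮ := by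
      rcases Nat.eq_zero_or_eq_succ_pred (m + i) with h0 | h0
      · rw [h0]
        exact hf 0 (by omega)
      · rw [h0]
        exact adjoint_apply_mem_orthogonal_ker T _
    rw [mul_smul]
    exact (h.1 _ hmem).isIterWeakDeriv_succ
      ((hcf f fun s hs => hf (s + 1) (by omega)).smul ε)

end Derivatives

/-! ### The operator form of the error estimate. -/

section ErrorEstimate

variable {α : Type*} [MeasurableSpace α] {μ : Measure α} [IsFiniteMeasure μ]

theorem tensorOp_comp_comp_apply (A Y B Y' D E : Lp ℝ 2 μ →L[ℝ] Lp ℝ 2 μ) (F : Lp ℝ 2 (μ.prod μ)) :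
    tensorOp (A ∘L Y) (B ∘L Y') (tensorOp D E F) = tensorOp (A ∘L Y ∘L D) (B ∘L Y' ∘L E) F := by
  have h := DFunLike.congr_fun (tensorOp_comp (A ∘L Y) (B ∘L Y') D E) F
  rw [ContinuousLinearMap.comp_assoc, ContinuousLinearMap.comp_assoc] at h
  exact h

/-- The two one-dimensional errors that make up the error of a tensor product. -/
theorem tensorOp_sub_tensorOp_comp {D E Y Z Y' Z' A B : Lp ℝ 2 μ →L[ℝ] Lp ℝ 2 μ}
    (hZ : Z = ContinuousLinearMap.id ℝ _ - Y) (hZ' : Z' = ContinuousLinearMap.id ℝ _ - Y') :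
    tensorOp (A ∘L D) (B ∘L E) - tensorOp (A ∘L Y ∘L D) (B ∘L Y' ∘L E) =
      tensorOp (A ∘L Z ∘L D) (B ∘L E) + tensorOp (A ∘L Y ∘L D) (B ∘L Z' ∘L E) := by
  have h1 : A ∘L Z ∘L D = A ∘L D - A ∘L Y ∘L D := by ext1 x; simp [hZ]
  have h2 : B ∘L Z' ∘L E = B ∘L E - B ∘L Y' ∘L E := by ext1 x; simp [hZ']
  rw [h1, h2, tensorOp_sub_left, tensorOp_sub_right]
  abel

/-- The mirror splitting leaves the projector in the second variable, where the `∂₂` estimate can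
bound it by one. -/
theorem tensorOp_sub_tensorOp_comp' {D E Y Z Y' Z' A B : Lp ℝ 2 μ →L[ℝ] Lp ℝ 2 μ}
    (hZ : Z = ContinuousLinearMap.id ℝ _ - Y) (hZ' : Z' = ContinuousLinearMap.id ℝ _ - Y') :
    tensorOp (A ∘L D) (B ∘L E) - tensorOp (A ∘L Y ∘L D) (B ∘L Y' ∘L E) =
      tensorOp (A ∘L Z ∘L D) (B ∘L Y' ∘L E) + tensorOp (A ∘L D) (B ∘L Z' ∘L E) := by
  have h1 : A ∘L Z ∘L D = A ∘L D - A ∘L Y ∘L D := by ext1 x; simp [hZ]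
  have h2 : B ∘L Z' ∘L E = B ∘L E - B ∘L Y' ∘L E := by ext1 x; simp [hZ']
  rw [h1, h2, tensorOp_sub_left, tensorOp_sub_right]
  abel

theorem norm_tensorOp_comp_apply_le_mul {T S T' S' : Lp ℝ 2 μ →L[ℝ] Lp ℝ 2 μ} {c d : ℝ}
    (hT : ‖T‖ ≤ c) (hS : ‖S‖ ≤ d) (F : Lp ℝ 2 (μ.prod μ)) :
    ‖tensorOp (T ∘L T') (S ∘L S') F‖ ≤ c * d * ‖tensorOp T' S' F‖ :=
  (norm_tensorOp_comp_apply_le T S T' S' F).trans (mul_le_mul_of_nonneg_right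
    (mul_le_mul hT hS (norm_nonneg _) ((norm_nonneg _).trans hT)) (norm_nonneg _))

/-- Error bounds for the tensor product of two projectors `Y`, `Y'` with complements `Z`, `Z'`,
where `D` factors both as `E P` and as `G L`. -/
theorem norm_tensorOp_error_le {K D E P G L Y Z Y' Z' : Lp ℝ 2 μ →L[ℝ] Lp ℝ 2 μ} {σ : ℝ} {s : ℕ}
    (hZ : Z = ContinuousLinearMap.id ℝ _ - Y) (hZ' : Z' = ContinuousLinearMap.id ℝ _ - Y')
    (hY1 : ‖Y‖ ≤ 1) (hY1' : ‖Y'‖ ≤ 1) (hZZ : Z ∘L Z = Z) (hZZ' : Z' ∘L Z' = Z')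
    (hEP : D = E ∘L P) (hGL : D = G ∘L L) (hKZ : ‖K ∘L Z‖ ≤ σ) (hKZ' : ‖K ∘L Z'‖ ≤ σ)
    (hZE : ‖Z ∘L E‖ ≤ σ ^ (s + 1)) (hZE' : ‖Z' ∘L E‖ ≤ σ ^ (s + 1))
    (hZG : ‖Z ∘L G‖ ≤ σ ^ s) (hZG' : ‖Z' ∘L G‖ ≤ σ ^ s) (F : Lp ℝ 2 (μ.prod μ)) :
    ‖tensorOp (K ∘L D) (K ∘L D) F - tensorOp (K ∘L Y ∘L D) (K ∘L Y' ∘L D) F‖ ≤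
        σ ^ (s + 2) * (‖tensorOp P (K ∘L D) F‖ + ‖tensorOp (K ∘L D) P F‖ +
          min ‖tensorOp D L F‖ ‖tensorOp L D F‖) ∧
      ‖tensorOp D (K ∘L D) F - tensorOp (Y ∘L D) (K ∘L Y' ∘L D) F‖ ≤
        σ ^ (s + 1) * (‖tensorOp P (K ∘L D) F‖ + ‖tensorOp D L F‖) ∧
      ‖tensorOp (K ∘L D) D F - tensorOp (K ∘L Y ∘L D) (Y' ∘L D) F‖ ≤
        σ ^ (s + 1) * (‖tensorOp L D F‖ + ‖tensorOp (K ∘L D) P F‖) := by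
  have hid : ‖ContinuousLinearMap.id ℝ (Lp ℝ 2 μ)‖ ≤ 1 := ContinuousLinearMap.norm_id_le
  have hfac : ∀ {Z B : Lp ℝ 2 μ →L[ℝ] Lp ℝ 2 μ} {m : ℕ}, Z ∘L Z = Z → ‖K ∘L Z‖ ≤ σ →
      ‖Z ∘L B‖ ≤ σ ^ m → ‖K ∘L Z ∘L B‖ ≤ σ ^ (m + 1) := fun {Z B m} h1 h2 h3 => by
    -- Idempotence of `Z` lets both neighbours gain: one `σ` from `K Z`, and `σ ^ m` from `Z B`.
    have he : K ∘L Z ∘L B = (K ∘L Z) ∘L (Z ∘L B) := by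
      conv_lhs => rw [← h1]
      simp only [ContinuousLinearMap.comp_assoc]
    rw [he, pow_succ']
    exact (ContinuousLinearMap.opNorm_comp_le _ _).trans
      (mul_le_mul h2 h3 (norm_nonneg _) ((norm_nonneg _).trans h2))
  have a1 : ‖tensorOp (K ∘L Z ∘L D) (K ∘L D) F‖ ≤ σ ^ (s + 2) * ‖tensorOp P (K ∘L D) F‖ := by
    have h := norm_tensorOp_comp_apply_le_mul (T' := P) (S' := K ∘L D) (hfac hZZ hKZ hZE) hid F
    rw [mul_one, ContinuousLinearMap.id_comp] at h
    simpa only [hEP, ContinuousLinearMap.comp_assoc] using h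
  have a2 : ‖tensorOp (K ∘L D) (K ∘L Z' ∘L D) F‖ ≤ σ ^ (s + 2) * ‖tensorOp (K ∘L D) P F‖ := by
    have h := norm_tensorOp_comp_apply_le_mul (T' := K ∘L D) (S' := P) hid (hfac hZZ' hKZ' hZE') F
    rw [one_mul, ContinuousLinearMap.id_comp] at h
    simpa only [hEP, ContinuousLinearMap.comp_assoc] using h
  -- The cross term gets one `σ` from one variable and `σ ^ (s + 1)` from the other; `a3` and `a4`
  -- exchange the roles.
  have a3 : ‖tensorOp (K ∘L Z ∘L D) (K ∘L Z' ∘L D) F‖ ≤ σ ^ (s + 2) * ‖tensorOp D L F‖ := by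
    have h := norm_tensorOp_comp_apply_le_mul (T' := D) (S' := L) hKZ (hfac hZZ' hKZ' hZG') F
    rw [← pow_succ'] at h
    have e : (K ∘L Z' ∘L G) ∘L L = K ∘L Z' ∘L D := by
      rw [hGL]; simp only [ContinuousLinearMap.comp_assoc]
    rwa [e, ContinuousLinearMap.comp_assoc] at h
  have a4 : ‖tensorOp (K ∘L Z ∘L D) (K ∘L Z' ∘L D) F‖ ≤ σ ^ (s + 2) * ‖tensorOp L D F‖ := by
    have h := norm_tensorOp_comp_apply_le_mul (T' := L) (S' := D) (hfac hZZ hKZ hZG) hKZ' F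
    rw [← pow_succ] at h
    have e : (K ∘L Z ∘L G) ∘L L = K ∘L Z ∘L D := by
      rw [hGL]; simp only [ContinuousLinearMap.comp_assoc]
    rwa [e, ContinuousLinearMap.comp_assoc K Z' D] at h
  have b1 : ‖tensorOp (Z ∘L D) (K ∘L D) F‖ ≤ σ ^ (s + 1) * ‖tensorOp P (K ∘L D) F‖ := by
    have h := norm_tensorOp_comp_apply_le_mul (T' := P) (S' := K ∘L D) hZE hid F
    rw [mul_one, ContinuousLinearMap.id_comp] at h
    simpa only [hEP, ContinuousLinearMap.comp_assoc] using h
  have b2 : ‖tensorOp (Y ∘L D) (K ∘L Z' ∘L D) F‖ ≤ σ ^ (s + 1) * ‖tensorOp D L F‖ := by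
    have h := norm_tensorOp_comp_apply_le_mul (T' := D) (S' := L) hY1 (hfac hZZ' hKZ' hZG') F
    have e : (K ∘L Z' ∘L G) ∘L L = K ∘L Z' ∘L D := by
      rw [hGL]; simp only [ContinuousLinearMap.comp_assoc]
    rwa [e, one_mul] at h
  have b3 : ‖tensorOp (K ∘L Z ∘L D) (Y' ∘L D) F‖ ≤ σ ^ (s + 1) * ‖tensorOp L D F‖ := by
    have h := norm_tensorOp_comp_apply_le_mul (T' := L) (S' := D) (hfac hZZ hKZ hZG) hY1' F
    have e : (K ∘L Z ∘L G) ∘L L = K ∘L Z ∘L D := by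
      rw [hGL]; simp only [ContinuousLinearMap.comp_assoc]
    rwa [e, mul_one] at h
  have b4 : ‖tensorOp (K ∘L D) (Z' ∘L D) F‖ ≤ σ ^ (s + 1) * ‖tensorOp (K ∘L D) P F‖ := by
    have h := norm_tensorOp_comp_apply_le_mul (T' := K ∘L D) (S' := P) hid hZE' F
    rw [one_mul, ContinuousLinearMap.id_comp] at h
    simpa only [hEP, ContinuousLinearMap.comp_assoc] using h
  refine ⟨?_, ?_, ?_⟩
  -- The two-term splitting contains `K Y D`, which is not controlled by `K D`; substituting `K Y D
  -- = K D - K Z D` produces the cross term.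
  · have e : tensorOp (K ∘L D) (K ∘L D) - tensorOp (K ∘L Y ∘L D) (K ∘L Y' ∘L D) =
        tensorOp (K ∘L Z ∘L D) (K ∘L D) + tensorOp (K ∘L D) (K ∘L Z' ∘L D) -
          tensorOp (K ∘L Z ∘L D) (K ∘L Z' ∘L D) := by
      have h1 : K ∘L Z ∘L D = K ∘L D - K ∘L Y ∘L D := by ext1 x; simp [hZ]
      rw [tensorOp_sub_tensorOp_comp hZ hZ', h1, tensorOp_sub_left, tensorOp_sub_left]
      abel
    rw [← sub_apply, e, sub_apply, add_apply]
    refine (norm_sub_le _ _).trans ((add_le_add (norm_add_le _ _) le_rfl).trans ?_)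
    rw [mul_add, mul_add]
    refine add_le_add (add_le_add a1 a2) ?_
    rcases min_choice ‖tensorOp D L F‖ ‖tensorOp L D F‖ with h | h
    · rwa [h]
    · rwa [h]
  · have e := tensorOp_sub_tensorOp_comp (D := D) (E := D) (A := ContinuousLinearMap.id ℝ _)
      (B := K) hZ hZ'
    simp only [ContinuousLinearMap.id_comp] at e
    rw [← sub_apply, e, add_apply, mul_add]
    exact (norm_add_le _ _).trans (add_le_add b1 b2)
  · have e := tensorOp_sub_tensorOp_comp' (D := D) (E := D) (A := K)
      (B := ContinuousLinearMap.id ℝ _) hZ hZ'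
    simp only [ContinuousLinearMap.id_comp] at e
    rw [← sub_apply, e, add_apply, mul_add]
    exact (norm_add_le _ _).trans (add_le_add b3 b4)

end ErrorEstimate

theorem sqrt_pow_eq_rpow_half {x : ℝ} (hx : 0 ≤ x) (m : ℕ) : √x ^ m = x ^ ((m : ℝ) / 2) := by
  rw [Real.sqrt_eq_rpow, ← Real.rpow_natCast, ← Real.rpow_mul hx]
  congr 1
  ring


/-! ### Derivatives of `u` and of the Ritz error. -/

section SmoothnessSpaces

variable {a b : ℝ}

theorem IsIntegration.isIterWeakDeriv_one {K : L2 a b →L[ℝ] L2 a b} (hint : IsIntegration K 1)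
    {B : L2 a b →L[ℝ] L2 a b} (hB : ∀ f, B f ∈ (LinearMap.ker (K : L2 a b →ₗ[ℝ] L2 a b))ᗮ)
    (f : L2 a b) : IsIterWeakDeriv 1 ((K ∘L B) f) (B f) := by
  have h := hint.1 (B f) (hB f)
  rw [one_smul] at h
  exact h.isIterWeakDeriv_succ (isIterWeakDeriv_zero _)

/-- The weak partial derivatives of the elements of `𝒦^r ⊗ 𝒦^r`. -/
theorem IsIntegration.exists_weakPartial_eq {K : L2 a b →L[ℝ] L2 a b} (hint : IsIntegration K 1)
    {s : ℕ} {u : L2Sq a b} (hu : u ∈ tensorSpace K (s + 2)) :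
    ∃ (P L : L2 a b →L[ℝ] L2 a b) (F : L2Sq a b),
      iterOp (K†) (s + 1) = iterOp (K†) (s + 1) ∘L P ∧
      iterOp (K†) (s + 1) = iterOp (K†) s ∘L L ∧
      u = tensorOp (K ∘L iterOp (K†) (s + 1)) (K ∘L iterOp (K†) (s + 1)) F ∧
      (∀ i j : ℕ, i ≤ s + 2 → j ≤ s + 2 → HasWeakPartial i j u) ∧
      ‖weakPartial (s + 2) 0 u‖ = ‖tensorOp P (K ∘L iterOp (K†) (s + 1)) F‖ ∧
      ‖weakPartial 0 (s + 2) u‖ = ‖tensorOp (K ∘L iterOp (K†) (s + 1)) P F‖ ∧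
      ‖weakPartial 1 (s + 1) u‖ = ‖tensorOp (iterOp (K†) (s + 1)) L F‖ ∧
      ‖weakPartial (s + 1) 1 u‖ = ‖tensorOp L (iterOp (K†) (s + 1)) F‖ := by
  set L := altAdj K (s + 1)
  set P := (LinearMap.ker (L : L2 a b →ₗ[ℝ] L2 a b))ᗮ.starProjection
  have hLP : L ∘L P = L := comp_starProjection_orthogonal_ker L
  -- `A i` is what remains of `K_r` after `i` derivatives. Inserting `P` does not change `K_r`, but
  -- makes the last of the `r` derivatives legitimate, as it needs an argument orthogonal to `ker
  -- L`.
  let A : ℕ → L2 a b →L[ℝ] L2 a b := fun i => iterOp (altAdj K i) (s + 2 - i) ∘L P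
  set G := iterOp (K†) s
  set E := iterOp (K†) (s + 1)
  have hEGL : E = G ∘L L := iterOp_succ_eq_comp_altAdj (K†) s
  have hEP : E = E ∘L P := by rw [hEGL, ContinuousLinearMap.comp_assoc, hLP]
  have hA0 : A 0 = K ∘L E := by
    change (K ∘L E) ∘L P = K ∘L E
    rw [ContinuousLinearMap.comp_assoc, ← hEP]
  have hA1 : A 1 = E := hEP.symm
  have hAr1 : A (s + 1) = L := by
    simp only [A, show s + 2 - (s + 1) = 1 by omega]
    exact hLP
  have hAr : A (s + 2) = P := by
    simp only [A, Nat.sub_self]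
    rfl
  have hder : ∀ i, i ≤ s + 2 → ∃ c : ℝ, |c| = 1 ∧
      ∀ f, IsIterWeakDeriv i ((K ∘L E) f) ((c • A i) f) := fun i hi => by
    obtain ⟨c, hc, hcf⟩ := hint.exists_isIterWeakDeriv_iterOp abs_one (s + 2 - i) i
    refine ⟨c, hc, fun f => ?_⟩
    have h := hcf (P f) fun t ht => by
      obtain rfl : t = s + 1 := by omega
      exact Submodule.starProjection_apply_mem _ f
    rw [Nat.sub_add_cancel hi] at h
    rw [← hA0]
    exact h
  obtain ⟨F, hF⟩ := hu
  replace hF : u = tensorOp (K ∘L E) (K ∘L E) F := hF.symm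
  have hpart : ∀ i j, i ≤ s + 2 → j ≤ s + 2 →
      ∃ c : ℝ, |c| = 1 ∧ IsWeakPartial i j u (c • tensorOp (A i) (A j) F) := fun i j hi hj => by
    obtain ⟨c, hc, hcf⟩ := hder i hi
    obtain ⟨d, hd, hdf⟩ := hder j hj
    refine ⟨c * d, by rw [abs_mul, hc, hd, one_mul], ?_⟩
    rw [hF, ← smul_apply, ← tensorOp_smul_smul]
    exact isWeakPartial_tensorOp hcf hdf F
  have hnorm : ∀ i j, i ≤ s + 2 → j ≤ s + 2 →
      ‖weakPartial i j u‖ = ‖tensorOp (A i) (A j) F‖ := fun i j hi hj => by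
    obtain ⟨c, hc, hcf⟩ := hpart i j hi hj
    rw [hcf.weakPartial_eq, norm_smul, Real.norm_eq_abs, hc, one_mul]
  refine ⟨P, L, F, hEP, hEGL, hF, fun i j hi hj => ?_, ?_, ?_, ?_, ?_⟩
  · obtain ⟨c, -, hc⟩ := hpart i j hi hj
    exact ⟨_, hc⟩
  · rw [hnorm _ _ le_rfl (Nat.zero_le _), hA0, hAr]
  · rw [hnorm _ _ (Nat.zero_le _) le_rfl, hA0, hAr]
  · rw [hnorm _ _ (by omega) (by omega), hA1, hAr1]
  · rw [hnorm _ _ (by omega) (by omega), hA1, hAr1]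

/-- The weak derivatives of the error of the tensor-product Ritz projector. -/
theorem IsIntegration.sub_tensorRitz {K : L2 a b →L[ℝ] L2 a b} (hint : IsIntegration K 1)
    {X0 Y0 : Submodule ℝ (L2 a b)} [FiniteDimensional ℝ X0] [FiniteDimensional ℝ Y0]
    (hY0ker : Y0 ≤ (LinearMap.ker (K : L2 a b →ₗ[ℝ] L2 a b))ᗮ) (p₁ p₂ : ℕ)
    {E : L2 a b →L[ℝ] L2 a b}
    (hE : ∀ f, E f ∈ (LinearMap.ker (K : L2 a b →ₗ[ℝ] L2 a b))ᗮ) {u F : L2Sq a b}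
    (hF : u = tensorOp (K ∘L E) (K ∘L E) F) {Y Y' : L2 a b →L[ℝ] L2 a b}
    (hY : Y = (approxSpace (K†) Y0 X0 (p₁ - 1)).starProjection)
    (hY' : Y' = (approxSpace (K†) Y0 X0 (p₂ - 1)).starProjection) :
    u - tensorRitz K X0 Y0 p₁ p₂ u =
        tensorOp (K ∘L E) (K ∘L E) F - tensorOp (K ∘L Y ∘L E) (K ∘L Y' ∘L E) F ∧
      IsWeakPartial 1 0 (u - tensorRitz K X0 Y0 p₁ p₂ u)
        (tensorOp E (K ∘L E) F - tensorOp (Y ∘L E) (K ∘L Y' ∘L E) F) ∧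
      IsWeakPartial 0 1 (u - tensorRitz K X0 Y0 p₁ p₂ u)
        (tensorOp (K ∘L E) E F - tensorOp (K ∘L Y ∘L E) (Y' ∘L E) F) := by
  have h11 : weakPartial 1 1 u = tensorOp E E F := by
    rw [hF]
    exact (isWeakPartial_tensorOp (hint.isIterWeakDeriv_one hE)
      (hint.isIterWeakDeriv_one hE) F).weakPartial_eq
  have hYmem : ∀ p f, ((approxSpace (K†) Y0 X0 (p - 1)).starProjection ∘L E) f ∈
      (LinearMap.ker (K : L2 a b →ₗ[ℝ] L2 a b))ᗮ := fun p f => by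
    have h := approxSpace_le_orthogonal_ker (T := K†) (X := Y0) (Y := X0)
      (by rwa [ContinuousLinearMap.adjoint_adjoint]) (p - 1)
    rw [ContinuousLinearMap.adjoint_adjoint] at h
    exact h (Submodule.starProjection_apply_mem _ _)
  have hsub : u - tensorRitz K X0 Y0 p₁ p₂ u =
      tensorOp (K ∘L E) (K ∘L E) F - tensorOp (K ∘L Y ∘L E) (K ∘L Y' ∘L E) F := by
    rw [tensorRitz, h11, ← hY, ← hY', tensorOp_comp_comp_apply, hF]
  have hYE : ∀ f, (Y ∘L E) f ∈ (LinearMap.ker (K : L2 a b →ₗ[ℝ] L2 a b))ᗮ := by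
    rw [hY]
    exact hYmem p₁
  have hYE' : ∀ f, (Y' ∘L E) f ∈ (LinearMap.ker (K : L2 a b →ₗ[ℝ] L2 a b))ᗮ := by
    rw [hY']
    exact hYmem p₂
  refine ⟨hsub, ?_, ?_⟩
  · rw [hsub]
    exact (isWeakPartial_tensorOp (hint.isIterWeakDeriv_one hE)
      (fun f => isIterWeakDeriv_zero _) F).sub
      (isWeakPartial_tensorOp (hint.isIterWeakDeriv_one hYE) (fun f => isIterWeakDeriv_zero _) F)
  · rw [hsub]
    exact (isWeakPartial_tensorOp (fun f => isIterWeakDeriv_zero _)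
      (hint.isIterWeakDeriv_one hE) F).sub
      (isWeakPartial_tensorOp (fun f => isIterWeakDeriv_zero _) (hint.isIterWeakDeriv_one hYE') F)

/-- The error bounds for the tensor-product Ritz projector, in terms of bounds for the errors of
the approximation spaces. -/
theorem IsIntegration.norm_sub_tensorRitz_le {K : L2 a b →L[ℝ] L2 a b} (hint : IsIntegration K 1)
    {X0 Y0 : Submodule ℝ (L2 a b)} [FiniteDimensional ℝ X0] [FiniteDimensional ℝ Y0]
    (hY0ker : Y0 ≤ (LinearMap.ker (K : L2 a b →ₗ[ℝ] L2 a b))ᗮ) {s p₁ p₂ : ℕ} (hp₁ : s + 1 ≤ p₁)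
    (hp₂ : s + 1 ≤ p₂) {σ : ℝ} (hσX : ‖X0ᗮ.starProjection ∘L K‖ ≤ σ)
    (hσY : ‖Y0ᗮ.starProjection ∘L K†‖ ≤ σ) {u : L2Sq a b} (hu : u ∈ tensorSpace K (s + 2)) :
    (∀ i j : ℕ, i ≤ s + 2 → j ≤ s + 2 → HasWeakPartial i j u) ∧
    HasWeakPartial 1 0 (u - tensorRitz K X0 Y0 p₁ p₂ u) ∧
    HasWeakPartial 0 1 (u - tensorRitz K X0 Y0 p₁ p₂ u) ∧
    ‖u - tensorRitz K X0 Y0 p₁ p₂ u‖ ≤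
      σ ^ (s + 2) * (‖weakPartial (s + 2) 0 u‖ + ‖weakPartial 0 (s + 2) u‖ +
        min ‖weakPartial 1 (s + 1) u‖ ‖weakPartial (s + 1) 1 u‖) ∧
    ‖weakPartial 1 0 (u - tensorRitz K X0 Y0 p₁ p₂ u)‖ ≤
      σ ^ (s + 1) * (‖weakPartial (s + 2) 0 u‖ + ‖weakPartial 1 (s + 1) u‖) ∧
    ‖weakPartial 0 1 (u - tensorRitz K X0 Y0 p₁ p₂ u)‖ ≤
      σ ^ (s + 1) * (‖weakPartial (s + 1) 1 u‖ + ‖weakPartial 0 (s + 2) u‖) := by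
  obtain ⟨P, L, F, hEP, hEGL, hF, hex, hr0, h0r, h1r, hr1⟩ := hint.exists_weakPartial_eq hu
  obtain ⟨hsub, h10, h01⟩ := hint.sub_tensorRitz (X0 := X0) (E := iterOp (K†) (s + 1)) hY0ker p₁ p₂
    (fun f => adjoint_apply_mem_orthogonal_ker K _) hF rfl rfl
  have hσX' : ‖X0ᗮ.starProjection ∘L (K†)†‖ ≤ σ := by
    rwa [ContinuousLinearMap.adjoint_adjoint]
  -- The Ritz projector onto `X_p` involves `Y_{p-1}`, so `p ≥ s + 1` allows all `s + 1` factors of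
  -- `D` to be used.
  have hYE : ∀ p m, m ≤ p - 1 + 1 →
      ‖(approxSpace (K†) Y0 X0 (p - 1))ᗮ.starProjection ∘L iterOp (K†) m‖ ≤ σ ^ m :=
    fun p m hm => norm_starProjection_approxSpace_comp_iterOp_le hσY hσX' hm
  have hKY : ∀ p, ‖K ∘L (approxSpace (K†) Y0 X0 (p - 1))ᗮ.starProjection‖ ≤ σ :=
    fun p => by
      rw [← norm_starProjection_comp_adjoint]
      exact norm_starProjection_approxSpace_comp_le hσY hσX' (p - 1)
  obtain ⟨e0, e1, e2⟩ := norm_tensorOp_error_le (K := K)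
    (Submodule.starProjection_orthogonal' (approxSpace (K†) Y0 X0 (p₁ - 1)))
    (Submodule.starProjection_orthogonal' (approxSpace (K†) Y0 X0 (p₂ - 1)))
    (Submodule.starProjection_norm_le _) (Submodule.starProjection_norm_le _)
    (starProjection_orthogonal_comp_of_le le_rfl) (starProjection_orthogonal_comp_of_le le_rfl)
    hEP hEGL (hKY p₁) (hKY p₂) (hYE p₁ (s + 1) (by omega)) (hYE p₂ (s + 1) (by omega))
    (hYE p₁ s (by omega)) (hYE p₂ s (by omega)) F
  rw [hr0, h0r, h1r, hr1, h10.weakPartial_eq, h01.weakPartial_eq]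
  refine ⟨hex, ⟨_, h10⟩, ⟨_, h01⟩, ?_, e1, e2⟩
  rw [hsub]
  exact e0

end SmoothnessSpaces

end TensorRitz

/-! ### The error bounds for optimal subspaces. -/

theorem mainTheorem8 {a b : ℝ} (hab : a < b)
    (k : ℝ → ℝ → ℝ) (K : L2 a b →L[ℝ] L2 a b) (hK : IsIntegralOperator k K)
    (hderiv : ∀ r : ℕ, ∀ f ∈ functionClass (K†) r, IsWeakDeriv (K f) f)
    (hderiv' : ∀ r : ℕ, ∀ g ∈ functionClass K r, IsWeakDeriv ((K†) g) (-g))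
    (lam : ℕ → ℝ) (hlam : IsEigenvalueSeq (K† ∘L K) lam)
    (n : ℕ) (X0 Y0 : Submodule ℝ (L2 a b)) [FiniteDimensional ℝ X0] [FiniteDimensional ℝ Y0]
    (hX0 : IsOptimal n (functionClass K 1) X0)
    (hY0 : IsOptimal n (functionClass (K†) 1) Y0)
    (hX0ker : X0 ≤ (LinearMap.ker (K† : L2 a b →ₗ[ℝ] L2 a b))ᗮ)
    (hY0ker : Y0 ≤ (LinearMap.ker (K : L2 a b →ₗ[ℝ] L2 a b))ᗮ)
    (r : ℕ) (hr : 2 ≤ r) (p₁ p₂ : ℕ) (hp₁ : r - 1 ≤ p₁) (hp₂ : r - 1 ≤ p₂)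
    (u : L2Sq a b) (hu : u ∈ tensorSpace K r) :
    (∀ i j : ℕ, i ≤ r → j ≤ r → HasWeakPartial i j u) ∧
    HasWeakPartial 1 0 (u - tensorRitz K X0 Y0 p₁ p₂ u) ∧
    HasWeakPartial 0 1 (u - tensorRitz K X0 Y0 p₁ p₂ u) ∧
    ‖u - tensorRitz K X0 Y0 p₁ p₂ u‖ ≤
      lam n ^ ((r : ℝ) / 2) * (‖weakPartial r 0 u‖ + ‖weakPartial 0 r u‖ +
        min ‖weakPartial 1 (r - 1) u‖ ‖weakPartial (r - 1) 1 u‖) ∧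
    ‖weakPartial 1 0 (u - tensorRitz K X0 Y0 p₁ p₂ u)‖ ≤
      lam n ^ (((r : ℝ) - 1) / 2) * (‖weakPartial r 0 u‖ + ‖weakPartial 1 (r - 1) u‖) ∧
    ‖weakPartial 0 1 (u - tensorRitz K X0 Y0 p₁ p₂ u)‖ ≤
      lam n ^ (((r : ℝ) - 1) / 2) * (‖weakPartial (r - 1) 1 u‖ + ‖weakPartial 0 r u‖) := by
  obtain ⟨s, rfl⟩ := Nat.exists_eq_add_of_le' hr
  -- The classes of order zero are the unit balls of the complements of the two kernels, so the
  -- derivative identities extend to these complements by scaling.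
  have hint : IsIntegration K 1 := by
    refine ⟨fun f hf => isWeakDeriv_of_forall_closedBall (V := _) (fun f hb hf => ?_) hf,
      fun g hg => isWeakDeriv_of_forall_closedBall (V := _) (fun g hb hg => ?_) hg⟩
    · rw [one_smul]
      exact hderiv 0 f ⟨hb, by rwa [ContinuousLinearMap.adjoint_adjoint]⟩
    · rw [neg_one_smul]
      exact hderiv' 0 g ⟨hb, hg⟩
  obtain ⟨hσX, hσY⟩ := norm_starProjection_comp_le_sqrt (not_finiteDimensional_L2 hab)
    hK.isCompactOperator hlam hX0 hY0
  have h := hint.norm_sub_tensorRitz_le hY0ker hp₁ hp₂ hσX hσY hu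
  have hcast : ((s + 2 : ℕ) : ℝ) - 1 = ((s + 1 : ℕ) : ℝ) := by
    push_cast
    ring
  rw [hcast, ← sqrt_pow_eq_rpow_half (hlam.2.1 n), ← sqrt_pow_eq_rpow_half (hlam.2.1 n)]
  exact h
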